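/- **Model.** Fix an integer $m\ge 1$ and reals $\alpha>\frac12$, $\beta\ge 0$, $\Delta>0$, $0<\delta<\frac{40}{81}$; put $g=e^{-\alpha\Delta}$ and assume $\beta<(1-\frac{81}{40}\delta)g^2\alpha$. Put $$\eta=\delta^2g^2\alpha,\qquad \mu=\frac{9e^{2\eta/27}}{(1-e^{-\eta/27})^2}.$$ *Blocks.* For $j=0,\dots,m$ there are $j$-blocks numbered $0,1,2,\dots$ in the order in which they are mined, finitely many in bounded time; block $0$ (genesis) is honest and mined at time $0$, the others are mined after time $0$. Proposer blocks are the $0$-blocks, voter blocks the $j$-blocks with $j\ge1$. Every non-genesis $j$-block has a parent $j$-block mined strictly earlier; following parents to the genesis block gives its $j$-blockchain, whose height is its number of non-genesis blocks. A block is published at some time (possibly never) not before it is mined. Blocks contain lists of transactions and reference links to blocks mined strictly earlier; a block counts as published only once its parent and all blocks it links to are published. A transaction in a published block is published. *Credible blockchains.* A $j$-blockchain is $t$-credible if it is published by time $t$ and no shorter than any $j$-blockchain published by time $t-\Delta$. An honest $j$-block is published when it is mined, and extends a $j$-blockchain that is credible at that time. *Votes.* A voter block may vote, by a reference link, for a proposer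 block of a height $h\ge1$; on each height only the first vote along a voter blockchain counts. An honest voter block mined at time $T$ votes on every height $h\ge1$ on which none of its ancestors has voted and on which some proposer block has been published by time $T-\Delta$. *References.* For an honest proposer block mined at time $T$, the blocks published by $T-\Delta$ are observable, blocks published at or after $T$ are not, and those published in between may or may not be; it links to every observable block that no observable block links to. *Leader sequences and ledger.* $(0,b_1,\dots,b_n)$ is a $t$-credible leader sequence if $n$ is at least the height of every proposer blockchain published by time $t-\Delta$ and there are $t$-credible $j$-blockchains, one for each $j=1,\dots,m$, such that for each $\ell\le n$ the block $b_\ell$ has the most votes from them among the proposer blocks of height $\ell$ published by time $t$, ties being broken by a rule that depends only on the set of tied blocks. Its ledger lists, for $\ell=1,\dots,n$ in turn, the blocks reachable from $b_\ell$ by a sequence of reference links but not from $b_1,\dots,b_{\ell-1}$, topologically sorted by a fixed rule; of redundant or conflicting transactions (those spending a common output) only the first is kept. A transaction is *credible until* $t$ if it is published by time $t$ and conflicts with no other transaction published by time $t$. It is *permanent after* $t$ if it is in the ledger of every $r'$-credible leader sequence with $r'\ge t$. *Randomness.* The honest non-genesis $j$-blocks, $j=0,\dots,m$, are mined at the points of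 independent Poisson processes of rate $\alpha$. For each $j$ and $0\le s<t$, the number of adversarial (i.e. not honest) $j$-blocks mined during $(s,t]$ is stochastically dominated by a Poisson variable with mean $\beta(t-s)$. Adversarial behaviour and network delays are otherwise arbitrary. *Typical events.* Let $N^j_{s,t},X^j_{s,t},Y^j_{s,t},Z^j_{s,t}$ be the numbers of honest $j$-blocks, $j$-laggers, $j$-loners and adversarial $j$-blocks mined during $(s,t]$, where a $j$-lagger mined at time $T$ is an honest $j$-block that is the only honest $j$-block mined during $[T-\Delta,T]$, and it is a $j$-loner if it is also the only one during $[T,T+\Delta]$. Let $E^j_{s,t}$ be the event that $$(1-\delta)(t-s)\alpha<N^j_{s,t}<(1+\delta)(t-s)\alpha,\quad X^j_{s,t}>(1-\delta)(t-s)g\alpha,$$ $$Y^j_{s,t}>(1-\delta)(t-s)g^2\alpha,\quad Z^j_{s,t}<(t-s)\beta+(t-s)g^2\alpha\delta,$$ and $G^j_{s,t}=\bigcap_{0\le a\le s,\ b\ge t}E^j_{a,b}$. **Theorem.** Let the integer $k$ and the reals $r,t$ satisfy $k\ge\frac{160\alpha(1+\Delta)}{\delta}$ and $$t=r+\frac{2(k+1)}{(1-\frac{41}{40}\delta)^2g^2(1-g)^2\alpha}+\Delta,$$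 and let $G=\bigcap_{j=0}^m G^j_{t-\frac{k}{2\alpha}+\Delta,\;t-\Delta}$. Then on $G$ every transaction that is credible until time $t$ and is contained in some block published by time $r$ is permanent after time $t$. Consequently this holds with probability at least $$1-(m+1)\mu e^{-\frac{\eta}{27}\left(\frac{k}{2\alpha}-2\Delta\right)};$$ precisely, $G$ contains a measurable event of at least this probability. -/

import Mathlib

open MeasureTheory ProbabilityTheory

/-- `(j, k)` is the `j`-block number `k`; number `0` is the genesis `j`-block. The `0`-blocks are
the proposer blocks and the `j`-blocks with `1 ≤ j ≤ m` are the voter blocks. -/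
abbrev Block (m : ℕ) := Fin (m + 1) × ℕ

/-- One complete outcome of the block production of a Prism system with `m` voter blockchains.
The requirements on these data are collected in `PrismOutcome.Valid`. -/
structure PrismOutcome (m : ℕ) (Tx : Type*) where
  /-- the time at which a block is mined -/
  minedAt : Block m → ℝ
  /-- the time at which a block is published (`⊤` if it never is) -/
  publishedAt : Block m → EReal
  /-- whether a block is honest (the other blocks are adversarial) -/
  honest : Block m → Prop
  /-- `parent j k` is the number, one of `0, …, k`, of the parent of the `j`-block `k + 1` -/
  parent : Fin (m + 1) → (k : ℕ) → Fin (k + 1)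
  /-- `ref b d`: the block `b` contains a reference link to the block `d` -/
  ref : Block m → Block m → Prop
  /-- `vote j b h` is the number of the proposer block of height `h` that block `b` of the voter
  blockchain `j` votes for (`none` if it does not vote on the height `h`). The voter blockchain
  `j : Fin m` consists of `j.succ`-blocks. -/
  vote : Fin m → ℕ → ℕ → Option ℕ
  /-- the transactions in a block, in their order -/
  txs : Block m → List Tx
  /-- the time at which a transaction is published -/
  txPublishedAt : Tx → EReal
  /-- the tie-breaking rule of the leader election: it selects one of several tied blocks -/
  tieBreak : Set ℕ → ℕ
  /-- the rule that sorts the blocks of an epoch -/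
  epochSort : Set (Block m) → List (Block m)

namespace PrismOutcome

variable {m : ℕ} {Tx : Type*} (S : PrismOutcome m Tx)

/-! ### Blockchains -/

/-- The height of a `j`-block: the number of non-genesis blocks in its blockchain. -/
def height (j : Fin (m + 1)) : ℕ → ℕ
  | 0 => 0
  | k + 1 => height j (S.parent j k) + 1
decreasing_by exact (S.parent j k).isLt

/-- `OnChain j a c`: the `j`-block `a` is on the `j`-blockchain `c`, i.e. it is reached from `c`
by following parents zero or more times. -/
def OnChain (j : Fin (m + 1)) (a c : ℕ) : Prop :=
  Relation.ReflTransGen (fun x y => ∃ k, y = k + 1 ∧ x = (S.parent j k : ℕ)) a c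

/-- The `j`-blockchain `b` is `t`-credible. -/
def Credible (Δ : ℝ) (j : Fin (m + 1)) (b : ℕ) (t : ℝ) : Prop :=
  S.publishedAt (j, b) ≤ (t : EReal) ∧
    ∀ k, S.publishedAt (j, k) ≤ ((t - Δ : ℝ) : EReal) → S.height j k ≤ S.height j b

/-! ### The rules for honest blocks -/

/-- An honest voter block votes on every height `h ≥ 1` of which a proposer block has been published
at least `Δ` before the voter block was mined, unless an ancestor has voted on `h` already. -/
def HonestVoting (Δ : ℝ) (j : Fin m) (b : ℕ) : Prop :=
  ∀ h, 1 ≤ h →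
    (∃ p, S.height 0 p = h ∧
      S.publishedAt (0, p) ≤ ((S.minedAt (j.succ, b) - Δ : ℝ) : EReal)) →
    (∀ a, S.OnChain j.succ a b → a ≠ b → S.vote j a h = none) →
    S.vote j b h ≠ none

/-- The honest proposer block `b` has a reference link to every block that is observable from it and
that no other observable block points to. All blocks published at least `Δ` before `b` are
observable, blocks published when `b` is or later are not, and those in between may or may not be:
`O` is the set of observable blocks. -/
def HonestReferences (Δ : ℝ) (b : ℕ) : Prop :=
  ∃ O : Set (Block m),
    (∀ d, S.publishedAt d ≤ ((S.minedAt (0, b) - Δ : ℝ) : EReal) → d ∈ O) ∧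
    (∀ d ∈ O, S.publishedAt d < (S.minedAt (0, b) : EReal)) ∧
    ∀ d ∈ O, (∀ c ∈ O, ¬ S.ref c d) → S.ref (0, b) d

/-- The laws of the Prism backbone protocol with delay bound `Δ`. Adversarial blocks are restricted
only by what holds for every valid block. -/
structure Valid (Δ : ℝ) : Prop where
  minedAt_genesis : ∀ j, S.minedAt (j, 0) = 0
  minedAt_pos : ∀ j k, 0 < S.minedAt (j, k + 1)
  /-- blocks are numbered in the order in which they are mined -/
  minedAt_mono : ∀ j, Monotone fun k => S.minedAt (j, k)
  /-- finitely many blocks are mined in bounded time -/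
  minedAt_tendsto : ∀ j, Filter.Tendsto (fun k => S.minedAt (j, k)) Filter.atTop Filter.atTop
  /-- a parent is mined strictly earlier -/
  minedAt_parent : ∀ j k, S.minedAt (j, (S.parent j k : ℕ)) < S.minedAt (j, k + 1)
  /-- a block is published after it is mined -/
  minedAt_le_publishedAt : ∀ b, (S.minedAt b : EReal) ≤ S.publishedAt b
  /-- a block counts as published only once its blockchain is -/
  publishedAt_parent :
    ∀ j k, S.publishedAt (j, (S.parent j k : ℕ)) ≤ S.publishedAt (j, k + 1)
  /-- reference links point to blocks mined strictly earlier -/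
  minedAt_ref : ∀ b d, S.ref b d → S.minedAt d < S.minedAt b
  /-- a block counts as published only once the blocks that it points to are -/
  publishedAt_ref : ∀ b d, S.ref b d → S.publishedAt d ≤ S.publishedAt b
  /-- a vote on the height `h` is a reference link to a proposer block of height `h` -/
  vote_height : ∀ j b h p, S.vote j b h = some p → S.height 0 p = h
  vote_ref : ∀ j b h p, S.vote j b h = some p → S.ref (j.succ, b) (0, p)
  /-- the transactions in a published block are published -/
  txPublishedAt_le : ∀ b, ∀ tx ∈ S.txs b, S.txPublishedAt tx ≤ S.publishedAt b
  honest_genesis : ∀ j, S.honest (j, 0)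
  /-- an honest block is published as soon as it is mined -/
  honest_publishedAt : ∀ b, S.honest b → S.publishedAt b = (S.minedAt b : EReal)
  /-- an honest block extends a blockchain that is credible when the block is mined -/
  honest_parent : ∀ j k, S.honest (j, k + 1) →
    S.Credible Δ j (S.parent j k : ℕ) (S.minedAt (j, k + 1))
  honest_voting : ∀ j b, S.honest (Fin.succ j, b) → S.HonestVoting Δ j b
  honest_references : ∀ b, S.honest (0, b) → S.HonestReferences Δ b
  tieBreak_mem : ∀ A : Set ℕ, A.Nonempty → S.tieBreak A ∈ A
  /-- a finite set of blocks is sorted topologically: no block precedes one that it points to -/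
  mem_epochSort : ∀ A : Set (Block m), A.Finite → ∀ b, b ∈ S.epochSort A ↔ b ∈ A
  nodup_epochSort : ∀ A : Set (Block m), A.Finite → (S.epochSort A).Nodup
  epochSort_topological :
    ∀ A : Set (Block m), A.Finite → (S.epochSort A).Pairwise fun b d => ¬ S.ref b d

/-! ### Credible leader sequences -/

/-- In the voter blockchain `j` that ends in block `c`, the valid vote on the height `h`, i.e. the
first one along the blockchain, is for the proposer block `p`. -/
def ChainVotes (j : Fin m) (c h p : ℕ) : Prop :=
  ∃ a, S.OnChain j.succ a c ∧ S.vote j a h = some p ∧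
    ∀ a', S.OnChain j.succ a' c → S.height j.succ a' < S.height j.succ a → S.vote j a' h = none

/-- The number of votes of the proposer block `p` of height `h` from the voter blockchains that end
in the blocks `C j`. -/
noncomputable def voteCount (C : Fin m → ℕ) (h p : ℕ) : ℕ :=
  {j : Fin m | S.ChainVotes j (C j) h p}.ncard

/-- The proposer blocks of height `h` published by time `t`. -/
def candidates (t : ℝ) (h : ℕ) : Set ℕ :=
  {p | S.height 0 p = h ∧ S.publishedAt (0, p) ≤ (t : EReal)}

/-- The proposer blocks of height `h` that receive the most votes at time `t`. -/
def topVoted (t : ℝ) (C : Fin m → ℕ) (h : ℕ) : Set ℕ :=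
  {p ∈ S.candidates t h | ∀ q ∈ S.candidates t h, S.voteCount C h q ≤ S.voteCount C h p}

/-- `(b 0, …, b n)` is a `t`-credible leader sequence (the values of `b` beyond `n` are
irrelevant). -/
def CredibleLeaderSeq (Δ : ℝ) (t : ℝ) (n : ℕ) (b : ℕ → ℕ) : Prop :=
  b 0 = 0 ∧
  (∀ k, S.publishedAt (0, k) ≤ ((t - Δ : ℝ) : EReal) → S.height 0 k ≤ n) ∧
  ∃ C : Fin m → ℕ, (∀ j, S.Credible Δ j.succ (C j) t) ∧
    ∀ h, 1 ≤ h → h ≤ n →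
      (S.topVoted t C h).Nonempty ∧ b h = S.tieBreak (S.topVoted t C h)

/-! ### The transaction ledger -/

/-- `Reaches b d`: the block `b` points to the block `d` by a sequence of reference links. -/
def Reaches (b d : Block m) : Prop := Relation.TransGen S.ref b d

/-- The blocks of the `h`-th epoch of the leader sequence `b`. -/
def epoch (b : ℕ → ℕ) (h : ℕ) : Set (Block m) :=
  {d | S.Reaches (0, b h) d ∧ ∀ i, 1 ≤ i → i < h → ¬ S.Reaches (0, b i) d}

end PrismOutcome

/-- Two transactions conflict if they both spend some common output; `spends tx` is the set of
outputs spent by the transaction `tx`. -/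
def Conflict {Tx Out : Type*} (spends : Tx → Set Out) (tx tx' : Tx) : Prop :=
  (spends tx ∩ spends tx').Nonempty

open Classical in
/-- Run through a list of transactions, keeping only the first one among redundant transactions
or double spends. -/
noncomputable def sanitize {Tx Out : Type*} (spends : Tx → Set Out) (l : List Tx) : List Tx :=
  l.foldl (fun kept tx =>
    if tx ∈ kept ∨ ∃ tx' ∈ kept, Conflict spends tx' tx then kept else kept ++ [tx]) []

namespace PrismOutcome

variable {m : ℕ} {Tx Out : Type*} (spends : Tx → Set Out) (S : PrismOutcome m Tx)

/-- The transaction ledger determined by the leader sequence `(b 0, …, b n)`. -/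
noncomputable def ledger (n : ℕ) (b : ℕ → ℕ) : List Tx :=
  sanitize spends
    ((List.range n).flatMap fun i => (S.epochSort (S.epoch b (i + 1))).flatMap S.txs)

/-- The transaction `tx` is credible until time `t`. -/
def CredibleTx (tx : Tx) (t : ℝ) : Prop :=
  S.txPublishedAt tx ≤ (t : EReal) ∧
    ∀ tx', tx' ≠ tx → S.txPublishedAt tx' ≤ (t : EReal) → ¬ Conflict spends tx tx'

/-- The transaction `tx` is permanent after time `t`: it is in the ledger of every `r`-credible
leader sequence with `r ≥ t`. -/
def PermanentTx (Δ : ℝ) (tx : Tx) (t : ℝ) : Prop :=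
  ∀ r, t ≤ r → ∀ n b, S.CredibleLeaderSeq Δ r n b → tx ∈ S.ledger spends n b

/-! ### Block counts, good events and typical events -/

/-- An honest `j`-block `k` is a `j`-lagger if it is the only honest `j`-block mined during
`[T - Δ, T]`, where `T` is the time when it is mined. -/
def Lagger (Δ : ℝ) (j : Fin (m + 1)) (k : ℕ) : Prop :=
  S.honest (j, k) ∧ ∀ l, S.honest (j, l) → S.minedAt (j, k) - Δ ≤ S.minedAt (j, l) →
    S.minedAt (j, l) ≤ S.minedAt (j, k) → l = k

/-- A `j`-lagger is a `j`-loner if it is also the only honest `j`-block mined during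
`[T, T + Δ]`. -/
def Loner (Δ : ℝ) (j : Fin (m + 1)) (k : ℕ) : Prop :=
  S.Lagger Δ j k ∧ ∀ l, S.honest (j, l) → S.minedAt (j, k) ≤ S.minedAt (j, l) →
    S.minedAt (j, l) ≤ S.minedAt (j, k) + Δ → l = k

/-- The numbers of the `j`-blocks mined during `(s, t]`. -/
def minedDuring (j : Fin (m + 1)) (s t : ℝ) : Set ℕ :=
  {k | s < S.minedAt (j, k) ∧ S.minedAt (j, k) ≤ t}

/-- The number of honest `j`-blocks mined during `(s, t]`. -/
noncomputable def numHonest (j : Fin (m + 1)) (s t : ℝ) : ℕ :=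
  {k ∈ S.minedDuring j s t | S.honest (j, k)}.ncard

/-- The number of `j`-laggers mined during `(s, t]`. -/
noncomputable def numLagger (Δ : ℝ) (j : Fin (m + 1)) (s t : ℝ) : ℕ :=
  {k ∈ S.minedDuring j s t | S.Lagger Δ j k}.ncard

/-- The number of `j`-loners mined during `(s, t]`. -/
noncomputable def numLoner (Δ : ℝ) (j : Fin (m + 1)) (s t : ℝ) : ℕ :=
  {k ∈ S.minedDuring j s t | S.Loner Δ j k}.ncard

/-- The number of adversarial `j`-blocks mined during `(s, t]`. -/
noncomputable def numAdversarial (j : Fin (m + 1)) (s t : ℝ) : ℕ :=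
  {k ∈ S.minedDuring j s t | ¬ S.honest (j, k)}.ncard

/-- The time when the `i`-th honest `j`-block is mined; the genesis block is the `0`-th one. -/
noncomputable def honestArrival (j : Fin (m + 1)) (i : ℕ) : ℝ :=
  S.minedAt (j, Nat.nth (fun k => S.honest (j, k)) i)

end PrismOutcome

/-- The propagation discount `g = exp (-α Δ)`. -/
noncomputable def discount (α Δ : ℝ) : ℝ := Real.exp (-(α * Δ))

/-- The exponent parameter `η = δ² g² α`. -/
noncomputable def etaParam (α δ Δ : ℝ) : ℝ := δ ^ 2 * discount α Δ ^ 2 * α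

/-- The parameter `μ = 9 exp (2 η / 27) / (1 - exp (-η / 27))²`. -/
noncomputable def muParam (α δ Δ : ℝ) : ℝ :=
  9 * Real.exp (2 / 27 * etaParam α δ Δ) / (1 - Real.exp (-(1 / 27 * etaParam α δ Δ))) ^ 2

namespace PrismOutcome

variable {m : ℕ} {Tx : Type*} (S : PrismOutcome m Tx)

/-- The `δ`-good event of the `j`-blocks with respect to the time interval `(s, t]` occurs. -/
def Good (α β δ Δ : ℝ) (j : Fin (m + 1)) (s t : ℝ) : Prop :=
  ((1 - δ) * (t - s) * α < S.numHonest j s t ∧ S.numHonest j s t < (1 + δ) * (t - s) * α) ∧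
  (1 - δ) * (t - s) * discount α Δ * α < S.numLagger Δ j s t ∧
  (1 - δ) * (t - s) * discount α Δ ^ 2 * α < S.numLoner Δ j s t ∧
  S.numAdversarial j s t < (t - s) * β + (t - s) * discount α Δ ^ 2 * α * δ

/-- The `δ`-typical event of the `j`-blocks on the time interval `(s, t]` occurs. -/
def Typical (α β δ Δ : ℝ) (j : Fin (m + 1)) (s t : ℝ) : Prop :=
  ∀ a b, 0 ≤ a → a ≤ s → t ≤ b → S.Good α β δ Δ j a b

end PrismOutcome

/-- The random outcome `S` of the Prism system under a fixed but arbitrary adversarial strategy: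
* the honest `j`-blocks arrive at the points of independent Poisson processes with rate `α`, i.e.
  all the times between consecutive honest `j`-blocks are independent and exponential with rate `α`;
* the number of adversarial `j`-blocks mined during `(s, t]` is stochastically dominated by a Poisson
  random variable with mean `β (t - s)`. -/
structure IsPrismModel {Ω : Type*} [MeasurableSpace Ω] {m : ℕ} {Tx : Type*} (P : Measure Ω)
    (S : Ω → PrismOutcome m Tx) (α β Δ : ℝ) : Prop where
  valid : ∀ ω, (S ω).Valid Δ
  measurable_minedAt : ∀ b, Measurable fun ω => (S ω).minedAt b
  measurableSet_honest : ∀ b, MeasurableSet {ω | (S ω).honest b}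
  honest_law : ∀ j i, HasLaw
    (fun ω => (S ω).honestArrival j (i + 1) - (S ω).honestArrival j i) (expMeasure α) P
  honest_indep : iIndepFun (fun (p : Fin (m + 1) × ℕ) ω =>
    (S ω).honestArrival p.1 (p.2 + 1) - (S ω).honestArrival p.1 p.2) P
  adversarial_bound : ∀ j s t, 0 ≤ s → s < t → ∀ a : ℝ, 0 ≤ a →
    Real.exp (-(β * (t - s))) *
        ∑ i ∈ Finset.range (⌊a⌋₊ + 1), (β * (t - s)) ^ i / (Nat.factorial i : ℝ) ≤
      P.real {ω | ((S ω).numAdversarial j s t : ℝ) ≤ a}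

/-- The intersection over `j = 0, …, m` of the typical events of the `j`-blocks on the time interval
`(s, t]`. -/
def typicalEvent {Ω : Type*} {m : ℕ} {Tx : Type*} (S : Ω → PrismOutcome m Tx)
    (α β δ Δ s t : ℝ) : Set Ω :=
  {ω | ∀ j, (S ω).Typical α β δ Δ j s t}

/-! The transaction survives because one special height h of the proposer tree settles it, whichever
leaders are elected. Laggers drive both halves of the argument. An honest block mined before a
lagger is strictly lower than it, so laggers have distinct heights. If every lagger of a period is
matched in height by an adversarial block of a comparable period, then adversarial blocks are at
least as numerous as laggers (`Valid.numLagger_le_numAdversarial`). Typicality forbids this on long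
intervals.

Put u = t - k/(2α). For voters, this contradiction shows that every chain credible at a time after t
contains an honest block mined in (u + Δ, t] (`Valid.exists_honest_onChain`). For proposers, it
yields a height h above all honest blocks mined before r + Δ, reached by time u, and having only
honest blocks among those mined by t (`Valid.exists_height_without_adversarial`). The honest voter
blocks have seen heights 1, …, h, so each voter chain's votes there go to blocks published by t.
Later leader sequences may disagree, but their leaders up to h are all published by t. The leader of
height h is therefore honest and mined no earlier than r + Δ, so it reaches the block with the
transaction. Anything listed in these epochs was published by t and cannot conflict with a credible
transaction (`permanentTx_of_credibleTx`).

For the probability, the gaps between honest blocks are independent and exponential. By lack of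
memory they restart afresh at any fixed time (`iidLaw_crossing_le`), so Chernoff bounds apply to
arrivals, laggers and loners in a given window; a Poisson tail handles adversarial blocks. Any
interval containing (s, t] lies between two windows whose endpoints are at integer distances from s
and t. A geometric union bound over these windows covers all intervals at once. -/

namespace PrismOutcome

/-! ### Ancestry, heights and mining times in a block tree. -/

section Chains

variable {m : ℕ} {Tx : Type*} {S : PrismOutcome m Tx} {Δ : ℝ} {j : Fin (m + 1)}

theorem height_succ (S : PrismOutcome m Tx) (j : Fin (m + 1)) (k : ℕ) :
    S.height j (k + 1) = S.height j (S.parent j k) + 1 := by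
  rw [height]

theorem height_zero (S : PrismOutcome m Tx) (j : Fin (m + 1)) : S.height j 0 = 0 := by
  rw [height]

theorem onChain_parent (S : PrismOutcome m Tx) (j : Fin (m + 1)) (k : ℕ) :
    S.OnChain j (S.parent j k) (k + 1) :=
  Relation.ReflTransGen.single ⟨k, rfl, rfl⟩

theorem OnChain.eq_or_parent {a k : ℕ} (h : S.OnChain j a (k + 1)) :
    a = k + 1 ∨ S.OnChain j a (S.parent j k) := by
  rcases Relation.ReflTransGen.cases_tail h with h | ⟨b, hb, k', hk', rfl⟩
  · exact Or.inl h.symm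
  · obtain rfl : k = k' := by omega
    exact Or.inr hb

theorem OnChain.le {a c : ℕ} (h : S.OnChain j a c) : a ≤ c := by
  induction h with
  | refl => exact le_rfl
  | tail _ h ih =>
    obtain ⟨k, rfl, rfl⟩ := h
    have := (S.parent j k).isLt
    omega

theorem OnChain.height_le {a c : ℕ} (h : S.OnChain j a c) : S.height j a ≤ S.height j c := by
  induction h with
  | refl => exact le_rfl
  | tail _ h ih =>
    obtain ⟨k, rfl, rfl⟩ := h
    rw [height_succ]
    omega

theorem Valid.minedAt_onChain_le (hV : S.Valid Δ) {a c : ℕ} (h : S.OnChain j a c) :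
    S.minedAt (j, a) ≤ S.minedAt (j, c) :=
  hV.minedAt_mono j h.le

theorem Valid.minedAt_onChain_lt (hV : S.Valid Δ) {a c : ℕ} (h : S.OnChain j a c) (hne : a ≠ c) :
    S.minedAt (j, a) < S.minedAt (j, c) := by
  rcases c with _ | k
  · exact absurd (Nat.le_zero.mp h.le) hne
  · exact (hV.minedAt_onChain_le (h.eq_or_parent.resolve_left hne)).trans_lt (hV.minedAt_parent j k)

theorem Valid.publishedAt_onChain_le (hV : S.Valid Δ) {a c : ℕ} (h : S.OnChain j a c) :
    S.publishedAt (j, a) ≤ S.publishedAt (j, c) := by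
  induction h with
  | refl => exact le_rfl
  | tail _ h ih =>
    obtain ⟨k, rfl, rfl⟩ := h
    exact ih.trans (hV.publishedAt_parent j k)

theorem onChain_genesis (S : PrismOutcome m Tx) (j : Fin (m + 1)) (c : ℕ) : S.OnChain j 0 c := by
  induction c using Nat.strong_induction_on with
  | _ c ih =>
    rcases c with _ | k
    · exact Relation.ReflTransGen.refl
    · exact (ih _ (S.parent j k).isLt).trans (S.onChain_parent j k)

theorem exists_onChain_height_eq {c h : ℕ} (hc : h ≤ S.height j c) :
    ∃ a, S.OnChain j a c ∧ S.height j a = h := by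
  induction c using Nat.strong_induction_on with
  | _ c ih =>
    rcases hc.eq_or_lt with rfl | hlt
    · exact ⟨c, Relation.ReflTransGen.refl, rfl⟩
    rcases c with _ | k
    · rw [height_zero] at hlt
      omega
    · rw [height_succ] at hlt
      obtain ⟨a, ha, rfl⟩ := ih _ (S.parent j k).isLt (Nat.lt_succ_iff.mp hlt)
      exact ⟨a, ha.trans (S.onChain_parent j k), rfl⟩

theorem OnChain.of_height_le {a b c : ℕ} (ha : S.OnChain j a c) (hb : S.OnChain j b c)
    (h : S.height j a ≤ S.height j b) : S.OnChain j a b := by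
  induction c using Nat.strong_induction_on with
  | _ c ih =>
    rcases c with _ | k
    · obtain rfl : a = 0 := Nat.le_zero.mp ha.le
      exact S.onChain_genesis j b
    rcases hb.eq_or_parent with rfl | hb'
    · exact ha
    rcases ha.eq_or_parent with rfl | ha'
    · have := hb'.height_le
      rw [height_succ] at h
      omega
    · exact ih _ (S.parent j k).isLt ha' hb'

theorem Valid.minedAt_nonneg (hV : S.Valid Δ) (b : Block m) : 0 ≤ S.minedAt b := by
  obtain ⟨j, k⟩ := b
  rcases k with _ | k
  · exact (hV.minedAt_genesis j).ge
  · exact (hV.minedAt_pos j k).le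

theorem Valid.finite_minedAt_le (hV : S.Valid Δ) (j : Fin (m + 1)) (t : ℝ) :
    {k | S.minedAt (j, k) ≤ t}.Finite := by
  obtain ⟨N, hN⟩ := ((hV.minedAt_tendsto j).eventually_gt_atTop t).exists_forall_of_atTop
  refine (Set.finite_lt_nat N).subset fun k hk => ?_
  by_contra hlt
  exact absurd (hN k (not_lt.mp hlt)) (not_lt.mpr hk)

theorem Valid.finite_minedDuring (hV : S.Valid Δ) (j : Fin (m + 1)) (s t : ℝ) :
    (S.minedDuring j s t).Finite :=
  (hV.finite_minedAt_le j t).subset fun _ hk => hk.2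

theorem Valid.finite_blocks_minedAt_le (hV : S.Valid Δ) (t : ℝ) :
    {d : Block m | S.minedAt d ≤ t}.Finite := by
  refine (Set.finite_iUnion fun j => (hV.finite_minedAt_le j t).image (Prod.mk j)).subset ?_
  rintro ⟨j, k⟩ hk
  exact Set.mem_iUnion.mpr ⟨j, k, hk, rfl⟩

theorem Valid.minedAt_le_of_publishedAt_le (hV : S.Valid Δ) {b : Block m} {t : ℝ}
    (h : S.publishedAt b ≤ (t : EReal)) : S.minedAt b ≤ t :=
  EReal.coe_le_coe_iff.mp ((hV.minedAt_le_publishedAt b).trans h)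

end Chains

/-! ### Matching laggers with adversarial blocks of the same height. -/

section Laggers

variable {m : ℕ} {Tx : Type*} {S : PrismOutcome m Tx} {Δ : ℝ} {j : Fin (m + 1)}

/-- No honest block falls in the last Δ before a lagger, so `a` was published early enough to bound
the height of the lagger's credible parent from below. -/
theorem Valid.height_lt_of_lagger (hV : S.Valid Δ) {a b : ℕ} (ha : S.honest (j, a))
    (hb : S.Lagger Δ j b) (hab : S.minedAt (j, a) < S.minedAt (j, b)) :
    S.height j a < S.height j b := by
  rcases b with _ | k
  · rw [hV.minedAt_genesis] at hab
    exact absurd hab (not_lt.mpr (hV.minedAt_nonneg _))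
  have hlt : S.minedAt (j, a) ≤ S.minedAt (j, k + 1) - Δ := by
    by_contra h
    have := hb.2 a ha (not_le.mp h).le hab.le
    rw [this] at hab
    exact lt_irrefl _ hab
  have := (hV.honest_parent j k hb.1).2 a (by
    rw [hV.honest_publishedAt _ ha]
    exact EReal.coe_le_coe_iff.mpr hlt)
  rw [height_succ]
  omega

theorem Valid.lagger_eq_of_height_eq (hV : S.Valid Δ) (hΔ : 0 < Δ) {a b : ℕ}
    (ha : S.Lagger Δ j a) (hb : S.Lagger Δ j b) (h : S.height j a = S.height j b) : a = b := by
  rcases lt_trichotomy (S.minedAt (j, a)) (S.minedAt (j, b)) with hlt | heq | hlt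
  · exact absurd h (hV.height_lt_of_lagger ha.1 hb hlt).ne
  · exact hb.2 a ha.1 (by linarith) heq.le
  · exact absurd h (hV.height_lt_of_lagger hb.1 ha hlt).ne'

/-- If every lagger mined in `(s, u]` is matched in height by an adversarial block mined in
`(s, T]`, then there are at least as many of the latter as of the former. -/
theorem Valid.numLagger_le_numAdversarial (hV : S.Valid Δ) (hΔ : 0 < Δ) {s u T : ℝ}
    (h : ∀ b, S.Lagger Δ j b → s < S.minedAt (j, b) → S.minedAt (j, b) ≤ u →
      ∃ c, ¬ S.honest (j, c) ∧ s < S.minedAt (j, c) ∧ S.minedAt (j, c) ≤ T ∧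
        S.height j c = S.height j b) :
    S.numLagger Δ j s u ≤ S.numAdversarial j s T := by
  have h' : ∀ b, ∃ c, b ∈ {k ∈ S.minedDuring j s u | S.Lagger Δ j k} →
      c ∈ {k ∈ S.minedDuring j s T | ¬ S.honest (j, k)} ∧ S.height j c = S.height j b := by
    intro b
    by_cases hb : b ∈ {k ∈ S.minedDuring j s u | S.Lagger Δ j k}
    · obtain ⟨c, h1, h2, h3, h4⟩ := h b hb.2 hb.1.1 hb.1.2
      exact ⟨c, fun _ => ⟨⟨⟨h2, h3⟩, h1⟩, h4⟩⟩
    · exact ⟨0, fun hb' => absurd hb' hb⟩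
  choose f hf using h'
  refine Set.ncard_le_ncard_of_injOn f (fun b hb => (hf b hb).1) (fun a ha b hb hab => ?_)
    ((hV.finite_minedDuring j s T).subset fun _ hk => hk.1)
  refine hV.lagger_eq_of_height_eq hΔ ha.2 hb.2 ?_
  rw [← (hf a ha).2, ← (hf b hb).2, hab]

/-- A credible blockchain contains a recent honest block, unless the laggers are outnumbered by
adversarial blocks on some long interval. -/
theorem Valid.exists_honest_onChain (hV : S.Valid Δ) (hΔ : 0 < Δ) {s' t : ℝ} (ht : 0 ≤ t)
    (hXZ : ∀ s T, 0 ≤ s → s ≤ s' → t ≤ T → ¬ S.numLagger Δ j s (T - Δ) ≤ S.numAdversarial j s T)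
    {c : ℕ} {T : ℝ} (hT : t ≤ T) (hc : S.Credible Δ j c T) :
    ∃ a, S.OnChain j a c ∧ S.honest (j, a) ∧ s' < S.minedAt (j, a) ∧ S.minedAt (j, a) ≤ t := by
  induction c using Nat.strong_induction_on generalizing T with
  | _ c ih =>
    -- An honest block mined after `t` extends a chain that was credible at that moment, so one can
    -- descend to its parent and use the induction hypothesis at the earlier time.
    by_cases hlate : ∃ a, S.OnChain j a c ∧ S.honest (j, a) ∧ t < S.minedAt (j, a)
    · obtain ⟨a, hac, hah, hat⟩ := hlate
      rcases a with _ | k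
      · rw [hV.minedAt_genesis] at hat
        exact absurd hat (not_lt.mpr ht)
      obtain ⟨a', ha', h⟩ := ih _ ((S.parent j k).isLt.trans_le hac.le) hat.le
        (hV.honest_parent j k hah)
      exact ⟨a', ha'.trans ((S.onChain_parent j k).trans hac), h⟩
    push Not at hlate
    classical
    let Q : ℕ → Prop := fun a => S.OnChain j a c ∧ S.honest (j, a)
    have hQ : Q (Nat.findGreatest Q c) :=
      Nat.findGreatest_spec (Nat.zero_le c) ⟨S.onChain_genesis j c, hV.honest_genesis j⟩
    -- `e` is the last honest block of the chain; above it the chain is purely adversarial. If `e`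
    -- were old, each lagger mined after it and by `T - Δ` would have a height between those of `e`
    -- and `c`, hence an adversarial partner on the chain.
    set e := Nat.findGreatest Q c
    refine ⟨e, hQ.1, hQ.2, ?_, hlate e hQ.1 hQ.2⟩
    by_contra hs
    refine hXZ _ T (hV.minedAt_nonneg (j, e)) (not_lt.mp hs) hT
      (hV.numLagger_le_numAdversarial hΔ fun b hb hsb hbT => ?_)
    have hbc : S.height j b ≤ S.height j c := hc.2 b (by
      rw [hV.honest_publishedAt _ hb.1]
      exact EReal.coe_le_coe_iff.mpr hbT)
    have heb := hV.height_lt_of_lagger hQ.2 hb hsb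
    obtain ⟨a, hac, hab⟩ := exists_onChain_height_eq hbc
    have hea : S.OnChain j e a := hQ.1.of_height_le hac (by omega)
    have hne : e ≠ a := by
      rintro rfl
      omega
    refine ⟨a, fun hah => hne (le_antisymm hea.le ?_), hV.minedAt_onChain_lt hea hne,
      hV.minedAt_le_of_publishedAt_le ((hV.publishedAt_onChain_le hac).trans hc.1), hab⟩
    exact Nat.le_findGreatest hac.le ⟨hac, hah⟩

/-- Some height beyond those of the honest blocks mined before `v` is reached by time `u` and not
occupied by adversarial blocks by time `t`, unless the laggers are outnumbered by adversarial blocks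
on some long interval. -/
theorem Valid.exists_height_without_adversarial (hV : S.Valid Δ) (hΔ : 0 < Δ) {v u t : ℝ}
    (hv : 0 < v) (hvt : v ≤ t)
    (hXZ : ∀ s, 0 ≤ s → s < v → ¬ S.numLagger Δ j s u ≤ S.numAdversarial j s t) :
    ∃ h, (∀ a, S.honest (j, a) → S.minedAt (j, a) < v → S.height j a < h) ∧
      (∃ a, S.height j a = h ∧ S.publishedAt (j, a) ≤ (u : EReal)) ∧
      ∀ a, S.height j a = h → S.minedAt (j, a) ≤ t → S.honest (j, a) := by
  obtain ⟨q, hq, hmax⟩ := Set.exists_max_image {a | S.honest (j, a) ∧ S.minedAt (j, a) < v}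
    (S.height j) ((hV.finite_minedAt_le j v).subset fun a ha => ha.2.le)
    ⟨0, hV.honest_genesis j, by rw [hV.minedAt_genesis]; exact hv⟩
  by_contra hcon
  push Not at hcon
  classical
  let Q : ℕ → Prop := fun h => ∀ a, S.height j a = h → S.minedAt (j, a) ≤ t → S.honest (j, a)
  have hQ0 : Q 0 := by
    intro a ha _
    rcases a with _ | k
    · exact hV.honest_genesis j
    · rw [height_succ] at ha
      omega
  -- This is the greatest height, up to that of the highest early honest block `q`, having only
  -- honest blocks by time `t`; height 0 always qualifies. Above it, heights up to that of `q` carry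
  -- adversarial blocks by maximality, and greater heights reached by `u` do so by the negated
  -- claim.
  have hQ : Q (Nat.findGreatest Q (S.height j q)) := Nat.findGreatest_spec (Nat.zero_le _) hQ0
  have hle : Nat.findGreatest Q (S.height j q) ≤ S.height j q := Nat.findGreatest_le _
  have hnot : ∀ h, Nat.findGreatest Q (S.height j q) < h → h ≤ S.height j q → ¬ Q h :=
    fun h h1 h2 => Nat.findGreatest_is_greatest h1 h2
  generalize Nat.findGreatest Q (S.height j q) = h₁ at hQ hle hnot
  obtain ⟨e₀, he₀q, he₀⟩ := exists_onChain_height_eq hle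
  -- The earliest block `e` of height `h₁` is chosen: every higher block has an ancestor of height
  -- `h₁`, so it is mined strictly after `e`. This places all adversarial partners in the counting
  -- interval.
  have hex : ∃ a, S.height j a = h₁ := ⟨e₀, he₀⟩
  have heh : S.height j (Nat.find hex) = h₁ := Nat.find_spec hex
  have hemin : ∀ a, S.height j a = h₁ → Nat.find hex ≤ a := fun a ha => Nat.find_min' hex ha
  generalize Nat.find hex = e at heh hemin
  have hev : S.minedAt (j, e) < v :=
    ((hV.minedAt_mono j (hemin e₀ he₀)).trans (hV.minedAt_onChain_le he₀q)).trans_lt hq.2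
  have hehon : S.honest (j, e) := hQ e heh (hev.le.trans hvt)
  refine hXZ _ (hV.minedAt_nonneg (j, e)) hev
    (hV.numLagger_le_numAdversarial hΔ fun b hb hsb hbu => ?_)
  have heb := hV.height_lt_of_lagger hehon hb hsb
  have hnQ : ∃ a, S.height j a = S.height j b ∧ S.minedAt (j, a) ≤ t ∧ ¬ S.honest (j, a) := by
    rcases le_or_gt (S.height j b) (S.height j q) with hbq | hbq
    · have := hnot _ (heh ▸ heb) hbq
      simp only [Q] at this
      push Not at this
      exact this
    · exact hcon _ (fun a ha hav => (hmax a ⟨ha, hav⟩).trans_lt hbq)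
        ⟨b, rfl, by rw [hV.honest_publishedAt _ hb.1]; exact EReal.coe_le_coe_iff.mpr hbu⟩
  obtain ⟨a, hab, hat, hah⟩ := hnQ
  obtain ⟨x, hxa, hx⟩ := exists_onChain_height_eq (S := S) (j := j) (c := a) (h := h₁) (by omega)
  refine ⟨a, hah, ?_, hat, hab⟩
  refine (hV.minedAt_mono j (hemin x hx)).trans_lt (hV.minedAt_onChain_lt hxa ?_)
  rintro rfl
  omega

end Laggers

/-! ### Votes, leaders and reference links. -/

section Leaders

variable {m : ℕ} {Tx : Type*} {S : PrismOutcome m Tx} {Δ : ℝ}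

/-- By the time the honest block `a` is mined, it or an ancestor has voted on `h`. The first vote on
the chain is thus cast no later than in `a`, and a vote is a reference link, so its target is
published no later than `a`. -/
theorem Valid.chainVotes_of_honest (hV : S.Valid Δ) {j : Fin m} {a c h : ℕ}
    (hac : S.OnChain j.succ a c) (ha : S.honest (j.succ, a)) (hh : 1 ≤ h)
    (hp : ∃ p, S.height 0 p = h ∧
      S.publishedAt (0, p) ≤ ((S.minedAt (j.succ, a) - Δ : ℝ) : EReal)) :
    (∃ p, S.ChainVotes j c h p) ∧
      ∀ p, S.ChainVotes j c h p → S.publishedAt (0, p) ≤ (S.minedAt (j.succ, a) : EReal) := by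
  have hx : ∃ x, S.OnChain j.succ x a ∧ S.vote j x h ≠ none := by
    by_contra hcon
    push Not at hcon
    exact hV.honest_voting j a ha h hh hp (fun x hx _ => hcon x hx)
      (hcon a Relation.ReflTransGen.refl)
  obtain ⟨x, hxa, hxv⟩ := hx
  refine ⟨?_, ?_⟩
  · classical
    have hex : ∃ y, S.OnChain j.succ y c ∧ S.vote j y h ≠ none := ⟨x, hxa.trans hac, hxv⟩
    obtain ⟨hy, hyv⟩ := Nat.find_spec hex
    obtain ⟨p, hp⟩ := Option.ne_none_iff_exists'.mp hyv
    refine ⟨p, _, hy, hp, fun z hz hlt => ?_⟩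
    by_contra hzv
    have hle := Nat.find_min' hex ⟨hz, hzv⟩
    have := (hz.of_height_le hy hlt.le).le
    have heq : z = Nat.find hex := le_antisymm this hle
    rw [← heq] at hlt
    exact lt_irrefl _ hlt
  · rintro p ⟨y, hy, hyp, hmin⟩
    have hyx : S.OnChain j.succ y x := by
      refine hy.of_height_le (hxa.trans hac) ?_
      by_contra hlt
      exact hxv (hmin x (hxa.trans hac) (not_le.mp hlt))
    calc S.publishedAt (0, p) ≤ S.publishedAt (j.succ, y) :=
          hV.publishedAt_ref _ _ (hV.vote_ref j y h p hyp)
      _ ≤ S.publishedAt (j.succ, a) := hV.publishedAt_onChain_le (hyx.trans hxa)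
      _ = _ := hV.honest_publishedAt _ ha

theorem ChainVotes.height_eq (hV : S.Valid Δ) {j : Fin m} {c h p : ℕ}
    (hp : S.ChainVotes j c h p) : S.height 0 p = h := by
  obtain ⟨a, -, ha, -⟩ := hp
  exact hV.vote_height j a h p ha

/-- Since `m ≥ 1`, some candidate gets a vote, so a winner gets one too; all voted blocks are
published by `t`. No majority or agreement among voters is needed. -/
theorem publishedAt_le_of_mem_topVoted (hV : S.Valid Δ) (hm : 1 ≤ m) {t r' : ℝ} (htr : t ≤ r')
    {C : Fin m → ℕ} {h : ℕ}
    (hC : ∀ j, (∃ p, S.ChainVotes j (C j) h p) ∧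
      ∀ p, S.ChainVotes j (C j) h p → S.publishedAt (0, p) ≤ (t : EReal))
    {p : ℕ} (hp : p ∈ S.topVoted r' C h) : S.publishedAt (0, p) ≤ (t : EReal) := by
  obtain ⟨q, hq⟩ := (hC ⟨0, hm⟩).1
  have hqc : q ∈ S.candidates r' h :=
    ⟨hq.height_eq hV, ((hC _).2 q hq).trans (EReal.coe_le_coe_iff.mpr htr)⟩
  have hpos : 0 < S.voteCount C h q := by
    rw [voteCount, Set.ncard_pos]
    exact ⟨_, hq⟩
  have hpos' := hpos.trans_le (hp.2 q hqc)
  rw [voteCount, Set.ncard_pos] at hpos'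
  obtain ⟨j, hj⟩ := hpos'
  exact (hC j).2 p hj

theorem Valid.publishedAt_reaches_le (hV : S.Valid Δ) {b d : Block m} (h : S.Reaches b d) :
    S.publishedAt d ≤ S.publishedAt b := by
  induction h with
  | single h => exact hV.publishedAt_ref _ _ h
  | tail _ h ih => exact (hV.publishedAt_ref _ _ h).trans ih

theorem Valid.minedAt_reaches_lt (hV : S.Valid Δ) {b d : Block m} (h : S.Reaches b d) :
    S.minedAt d < S.minedAt b := by
  induction h with
  | single h => exact hV.minedAt_ref _ _ h
  | tail _ h ih => exact (hV.minedAt_ref _ _ h).trans ih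

theorem Valid.finite_epoch (hV : S.Valid Δ) (b : ℕ → ℕ) (h : ℕ) : (S.epoch b h).Finite :=
  (hV.finite_blocks_minedAt_le (S.minedAt (0, b h))).subset
    fun _ hd => (hV.minedAt_reaches_lt hd.1).le

/-- An honest proposer block reaches every block published at least `Δ` before it. -/
theorem Valid.reaches_of_honest (hV : S.Valid Δ) {b : ℕ} (hb : S.honest (0, b)) {d : Block m}
    (hd : S.publishedAt d ≤ ((S.minedAt (0, b) - Δ : ℝ) : EReal)) : S.Reaches (0, b) d := by
  obtain ⟨O, hO1, hO2, hO3⟩ := hV.honest_references b hb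
  have hfin : O.Finite := (hV.finite_blocks_minedAt_le (S.minedAt (0, b))).subset fun c hc =>
    hV.minedAt_le_of_publishedAt_le (hO2 c hc).le
  -- The latest-mined observable block leading to `d` has no observable block linking to it, so the
  -- honest block must link to it.
  obtain ⟨c, ⟨hcO, hcd⟩, hmax⟩ := Set.exists_max_image
    {c ∈ O | Relation.ReflTransGen S.ref c d} S.minedAt (hfin.subset fun _ hc => hc.1)
    ⟨d, hO1 d hd, Relation.ReflTransGen.refl⟩
  refine Relation.TransGen.head' (hO3 c hcO fun c' hc' href => ?_) hcd
  exact absurd (hV.minedAt_ref _ _ href)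
    (not_lt.mpr (hmax c' ⟨hc', Relation.ReflTransGen.head href hcd⟩))

end Leaders

end PrismOutcome

/-! ### Survival of a transaction in the ledger. -/

section Sanitize

variable {Tx Out : Type*} {spends : Tx → Set Out}

-- Kept entries are never removed, and when `tx` is first met in `l₁` nothing kept so far conflicts
-- with it. The suffix `l₂` is harmless because it comes later.
open Classical in
theorem mem_sanitize_append {l₁ l₂ : List Tx} {tx : Tx} (htx : tx ∈ l₁)
    (h : ∀ tx' ∈ l₁, tx' ≠ tx → ¬ Conflict spends tx' tx) : tx ∈ sanitize spends (l₁ ++ l₂) := by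
  have hkeep : ∀ (l kept : List Tx), tx ∈ kept → tx ∈ l.foldl (fun kept tx =>
      if tx ∈ kept ∨ ∃ tx' ∈ kept, Conflict spends tx' tx then kept else kept ++ [tx]) kept := by
    intro l
    induction l with
    | nil => exact fun _ hk => hk
    | cons a l ih =>
      intro kept hk
      rw [List.foldl_cons]
      apply ih
      split_ifs
      · exact hk
      · exact List.mem_append_left _ hk
  have hadd : ∀ (l kept : List Tx), (∀ tx' ∈ l, tx' ≠ tx → ¬ Conflict spends tx' tx) →
      (∀ tx' ∈ kept, tx' ≠ tx → ¬ Conflict spends tx' tx) → tx ∈ l →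
      tx ∈ l.foldl (fun kept tx =>
        if tx ∈ kept ∨ ∃ tx' ∈ kept, Conflict spends tx' tx then kept else kept ++ [tx]) kept := by
    intro l
    induction l with
    | nil => intro _ _ _ hl; simp at hl
    | cons a l ih =>
      intro kept hl hk hmem
      rw [List.foldl_cons]
      by_cases ha : a = tx
      · subst ha
        apply hkeep
        split_ifs with hif
        · rcases hif with hif | ⟨tx', htx', hc⟩
          · exact hif
          · by_cases hne : tx' = a
            · exact hne ▸ htx'
            · exact absurd hc (hk tx' htx' hne)
        · simp
      · refine ih _ (fun x hx => hl x (List.mem_cons_of_mem _ hx)) ?_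
          ((List.mem_cons.mp hmem).resolve_left (Ne.symm ha))
        split_ifs
        · exact hk
        · intro x hx
          rcases List.mem_append.mp hx with hx | hx
          · exact hk x hx
          · rw [List.mem_singleton.mp hx]
            exact hl a List.mem_cons_self
  rw [sanitize, List.foldl_append]
  exact hkeep _ _ (hadd _ _ h (by simp) htx)

end Sanitize

namespace PrismOutcome

section Ledger

variable {m : ℕ} {Tx Out : Type*} {spends : Tx → Set Out} {S : PrismOutcome m Tx} {Δ : ℝ}

/-- The ledger is cut after epoch `h`. Blocks in the first part are reached from leaders published
by `t`, so all their transactions are published by `t` and cannot conflict with `tx`. -/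
theorem mem_ledger_of_reaches (hV : S.Valid Δ) {b : ℕ → ℕ} {n h : ℕ} (hh : 1 ≤ h) (hhn : h ≤ n)
    {t : ℝ} (hpub : ∀ i, 1 ≤ i → i ≤ h → S.publishedAt (0, b i) ≤ (t : EReal))
    {d : Block m} (hd : S.Reaches (0, b h) d) {tx : Tx} (htx : tx ∈ S.txs d)
    (hcred : S.CredibleTx spends tx t) : tx ∈ S.ledger spends n b := by
  obtain ⟨e, rfl⟩ := Nat.exists_eq_add_of_le hhn
  rw [ledger, List.range_add, List.flatMap_append]
  apply mem_sanitize_append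
  · classical
    -- The block `d` belongs to the epoch of the first leader that reaches it, possibly earlier than
    -- `h`.
    have hex : ∃ i, 1 ≤ i ∧ S.Reaches (0, b i) d := ⟨h, hh, hd⟩
    obtain ⟨hi1, hi⟩ := Nat.find_spec hex
    have hih : Nat.find hex ≤ h := Nat.find_min' hex ⟨hh, hd⟩
    have hmin : ∀ i', 1 ≤ i' → i' < Nat.find hex → ¬ S.Reaches (0, b i') d :=
      fun i' h1 h2 h3 => Nat.find_min hex h2 ⟨h1, h3⟩
    generalize Nat.find hex = i at hi1 hi hih hmin
    refine List.mem_flatMap.mpr ⟨i - 1, List.mem_range.mpr (by omega), ?_⟩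
    rw [Nat.sub_add_cancel hi1]
    exact List.mem_flatMap.mpr ⟨d, (hV.mem_epochSort _ (hV.finite_epoch b i) d).mpr ⟨hi, hmin⟩, htx⟩
  · intro tx' htx' hne hconf
    obtain ⟨i, hi, htx'⟩ := List.mem_flatMap.mp htx'
    obtain ⟨d', hd', htx'⟩ := List.mem_flatMap.mp htx'
    rw [hV.mem_epochSort _ (hV.finite_epoch b _)] at hd'
    refine hcred.2 tx' hne ?_ (by rwa [Conflict, Set.inter_comm])
    exact ((hV.txPublishedAt_le d' tx' htx').trans (hV.publishedAt_reaches_le hd'.1)).trans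
      (hpub _ (by omega) (by have := List.mem_range.mp hi; omega))

/-- A transaction that is credible until `t` and was published by `r` is permanent after `t`, unless
the laggers are outnumbered by adversarial blocks on some long interval. -/
theorem permanentTx_of_credibleTx (hV : S.Valid Δ) (hΔ : 0 < Δ) (hm : 1 ≤ m) {r u t : ℝ}
    (hr : r + Δ ≤ t) (hut : u + Δ ≤ t)
    (hvoter : ∀ j s T, 0 ≤ s → s ≤ u + Δ → t ≤ T →
      ¬ S.numLagger Δ j s (T - Δ) ≤ S.numAdversarial j s T)
    (hproposer : ∀ s, 0 ≤ s → s < r + Δ → ¬ S.numLagger Δ 0 s u ≤ S.numAdversarial 0 s t)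
    {tx : Tx} (hcred : S.CredibleTx spends tx t)
    (htx : ∃ d, tx ∈ S.txs d ∧ S.publishedAt d ≤ (r : EReal)) :
    S.PermanentTx spends Δ tx t := by
  obtain ⟨d, hdtx, hdr⟩ := htx
  have hr0 : 0 ≤ r := (hV.minedAt_nonneg d).trans (hV.minedAt_le_of_publishedAt_le hdr)
  have ht0 : 0 ≤ t := by linarith
  obtain ⟨h, hlow, ⟨p, hph, hpu⟩, hadv⟩ := hV.exists_height_without_adversarial hΔ
    (v := r + Δ) (u := u) (t := t) (by linarith) hr hproposer
  have hh : 1 ≤ h := by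
    have := hlow 0 (hV.honest_genesis 0) (by rw [hV.minedAt_genesis]; linarith)
    omega
  intro r' hr' n b hb
  obtain ⟨-, hn, C, hC, hlead⟩ := hb
  have hhn : h ≤ n := by
    rw [← hph]
    exact hn p (hpu.trans (EReal.coe_le_coe_iff.mpr (by linarith)))
  have htop : ∀ i, 1 ≤ i → i ≤ h → b i ∈ S.topVoted r' C i := by
    intro i h1 h2
    obtain ⟨hne, hbi⟩ := hlead i h1 (h2.trans hhn)
    rw [hbi]
    exact hV.tieBreak_mem _ hne
  -- Each voter chain has an honest block mined in `(u + Δ, t]`. The ancestors of `p` give a block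
  -- of every height up to `h` published by `u`, hence at least Δ before that voter block.
  have hpub : ∀ i, 1 ≤ i → i ≤ h → S.publishedAt (0, b i) ≤ (t : EReal) := by
    intro i h1 h2
    refine publishedAt_le_of_mem_topVoted hV hm hr' (fun j => ?_) (htop i h1 h2)
    obtain ⟨a, hac, hah, hua, hat⟩ :=
      hV.exists_honest_onChain hΔ ht0 (hvoter j.succ) hr' (hC j)
    obtain ⟨p', hp'p, hp'⟩ := exists_onChain_height_eq (S := S) (j := 0) (c := p) (h := i) (by omega)
    have := hV.chainVotes_of_honest hac hah h1 ⟨p', hp', ((hV.publishedAt_onChain_le hp'p).trans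
      hpu).trans (EReal.coe_le_coe_iff.mpr (by linarith))⟩
    exact ⟨this.1, fun q hq => (this.2 q hq).trans (EReal.coe_le_coe_iff.mpr hat)⟩
  have hbh : S.height 0 (b h) = h := (htop h hh le_rfl).1.1
  have hhon : S.honest (0, b h) :=
    hadv _ hbh (hV.minedAt_le_of_publishedAt_le (hpub h hh le_rfl))
  have hmined : r + Δ ≤ S.minedAt (0, b h) := by
    by_contra hlt
    have := hlow _ hhon (not_le.mp hlt)
    omega
  exact mem_ledger_of_reaches hV hh hhn hpub (hV.reaches_of_honest hhon
    (hdr.trans (EReal.coe_le_coe_iff.mpr (by linarith)))) hdtx hcred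

end Ledger

end PrismOutcome

/-! ### Lagger and adversary counts on the typical event. -/

section Parameters

variable {α δ Δ : ℝ}

theorem discount_pos (α Δ : ℝ) : 0 < discount α Δ := Real.exp_pos _

theorem discount_lt_one (hα : 0 < α) (hΔ : 0 < Δ) : discount α Δ < 1 :=
  Real.exp_lt_one_iff.mpr (neg_lt_zero.mpr (mul_pos hα hΔ))

end Parameters

namespace PrismOutcome

variable {m : ℕ} {Tx : Type*} {S : PrismOutcome m Tx} {α β δ Δ : ℝ}

theorem Valid.numLagger_le_add (hV : S.Valid Δ) (j : Fin (m + 1)) (s u w : ℝ) :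
    S.numLagger Δ j s w ≤ S.numLagger Δ j s u + S.numHonest j u w := by
  refine (Set.ncard_le_ncard ?_ ?_).trans (Set.ncard_union_le _ _)
  · rintro k ⟨⟨h1, h2⟩, h3⟩
    rcases le_or_gt (S.minedAt (j, k)) u with h | h
    · exact Or.inl ⟨⟨h1, h⟩, h3⟩
    · exact Or.inr ⟨⟨h, h2⟩, h3.1⟩
  · exact ((hV.finite_minedDuring j s u).subset fun _ hk => hk.1).union
      ((hV.finite_minedDuring j u w).subset fun _ hk => hk.1)

/-- The adversarial rate is at most (1 - 81δ/40 + δ)g²α = (1 - 41δ/40)g²α, against a lagger rate (1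
- δ)gα. Even after bounding one factor g by 1, the margin δ/40 over the whole interval outweighs the
Δ lost at its end. -/
theorem Typical.numAdversarial_lt_of_long {j : Fin (m + 1)} {s' t : ℝ}
    (hG : S.Typical α β δ Δ j s' (t - Δ)) (hα : 0 < α) (hδ : 0 < δ) (hδ' : δ < 40 / 81)
    (hΔ : 0 < Δ) (hrate : β < (1 - 81 / 40 * δ) * discount α Δ ^ 2 * α)
    (hlong : 40 * Δ ≤ δ * (t - s')) {s T : ℝ} (hs : 0 ≤ s) (hss' : s ≤ s') (hT : t ≤ T) :
    ¬ S.numLagger Δ j s (T - Δ) ≤ S.numAdversarial j s T := by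
  intro hle
  have hX := (hG s (T - Δ) hs hss' (by linarith)).2.1
  have hZ := (hG s T hs hss' (by linarith)).2.2.2
  have hle' : (S.numLagger Δ j s (T - Δ) : ℝ) ≤ S.numAdversarial j s T := by exact_mod_cast hle
  have hg := discount_pos α Δ
  have hg1 := discount_lt_one hα hΔ
  set g := discount α Δ
  have hτ : 0 < T - s := by nlinarith
  have h1 : (T - s) * β ≤ (T - s) * ((1 - 81 / 40 * δ) * g ^ 2 * α) :=
    mul_le_mul_of_nonneg_left hrate.le hτ.le
  have h2 : g * α * ((1 - δ) * (T - Δ - s)) < g * α * ((T - s) * (1 - 41 / 40 * δ) * g) := by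
    nlinarith
  have h3 : (1 - δ) * (T - Δ - s) < (T - s) * (1 - 41 / 40 * δ) * g :=
    lt_of_mul_lt_mul_left h2 (by positivity)
  have h4 : (T - s) * (1 - 41 / 40 * δ) * g ≤ (T - s) * (1 - 41 / 40 * δ) :=
    mul_le_of_le_one_right (mul_nonneg hτ.le (by linarith)) hg1.le
  have h5 : δ * (t - s') ≤ δ * (T - s) := mul_le_mul_of_nonneg_left (by linarith) hδ.le
  nlinarith [mul_pos hδ hΔ]

/-- Typicality says nothing directly about intervals ending at `u`. Laggers are therefore counted up
to `t - Δ`, and all honest blocks after `u`, about k/2 of them, are given away. The surplus of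
laggers over adversarial blocks, of rate at least gαc(1 - g) with c = 1 - 41δ/40, pays for this when
`t - s` is long. -/
theorem Typical.numAdversarial_lt_of_early (hV : S.Valid Δ) {j : Fin (m + 1)} {u t : ℝ}
    (hG : S.Typical α β δ Δ j (u + Δ) (t - Δ)) (hα : 0 < α) (hδ : 0 < δ) (hδ' : δ < 40 / 81)
    (hΔ : 0 < Δ) (hrate : β < (1 - 81 / 40 * δ) * discount α Δ ^ 2 * α) {k s : ℝ} (hk : 0 ≤ k)
    (htu : (t - u) * α = k / 2) (hs : 0 ≤ s) (hsu : s ≤ u)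
    (hts : 2 * (k + 1) / ((1 - 41 / 40 * δ) ^ 2 * discount α Δ ^ 2 * (1 - discount α Δ) ^ 2 * α) ≤
      t - s) :
    ¬ S.numLagger Δ j s u ≤ S.numAdversarial j s t := by
  intro hle
  have hX := (hG s (t - Δ) hs (by linarith) le_rfl).2.1
  have hZ := (hG s t hs (by linarith) (by linarith)).2.2.2
  have hN := (hG u (t - Δ) (by linarith) (by linarith) le_rfl).1.2
  have hle' : (S.numLagger Δ j s u : ℝ) ≤ S.numAdversarial j s t := by exact_mod_cast hle
  have hsplit : (S.numLagger Δ j s (t - Δ) : ℝ) ≤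
      S.numLagger Δ j s u + S.numHonest j u (t - Δ) := by
    exact_mod_cast hV.numLagger_le_add j s u (t - Δ)
  have hg := discount_pos α Δ
  have hg1 := discount_lt_one hα hΔ
  set g := discount α Δ
  set c := 1 - 41 / 40 * δ with hc
  have hc0 : 0 < c := by linarith
  have hc1 : c < 1 := by linarith
  have hg1' : 0 < 1 - g := by linarith
  rw [div_le_iff₀ (by positivity)] at hts
  have hτ : 0 ≤ t - s := by
    by_contra hneg
    have : (t - s) * (c ^ 2 * g ^ 2 * (1 - g) ^ 2 * α) ≤ 0 :=
      mul_nonpos_of_nonpos_of_nonneg (by linarith) (by positivity)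
    linarith
  have h1 : (t - s) * β ≤ (t - s) * ((1 - 81 / 40 * δ) * g ^ 2 * α) :=
    mul_le_mul_of_nonneg_left hrate.le hτ
  have hgΔ : (1 - δ) * Δ * g * α ≤ (1 + δ) * Δ * α := by
    have : (1 - δ) * g ≤ 1 + δ := by nlinarith
    nlinarith [mul_le_mul_of_nonneg_right this (mul_pos hΔ hα).le]
  have h2 : (t - s) * (g * α * (c * (1 - g))) < (1 + δ) * (k / 2) := by
    have h3 : 0 ≤ (t - s) * (g * α) * δ := by positivity
    have h4 : (1 + δ) * (t - Δ - u) * α = (1 + δ) * (k / 2) - (1 + δ) * Δ * α := by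
      rw [← htu]; ring
    have h5 : (t - s) * (g * α * (c * (1 - g))) =
      (1 - δ) * (t - Δ - s) * g * α + (1 - δ) * Δ * g * α - 1 / 40 * ((t - s) * (g * α) * δ)
       - ((t - s) * ((1 - 81 / 40 * δ) * g ^ 2 * α) + (t - s) * g ^ 2 * α * δ) := by
      rw [hc]; ring
    linarith
  -- The squares in the prescribed waiting time are stronger than needed. The result is 2(k + 1) <
  -- (1 + δ)k/2, which is absurd.
  have h6 : (t - s) * (c ^ 2 * g ^ 2 * (1 - g) ^ 2 * α) ≤ (t - s) * (g * α * (c * (1 - g))) := by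
    have h7 : c * g * (1 - g) ≤ 1 := by
      have : c * g ≤ 1 := mul_le_one₀ hc1.le hg.le hg1.le
      exact mul_le_one₀ this hg1'.le (by linarith)
    have h8 : 0 ≤ (t - s) * (g * α * (c * (1 - g))) := by positivity
    nlinarith [mul_le_mul_of_nonneg_left h7 h8]
  nlinarith

theorem permanentTx_of_typical (hV : S.Valid Δ) (hm : 1 ≤ m) {Out : Type*} {spends : Tx → Set Out}
    (hα : 1 / 2 < α) (hδ : 0 < δ) (hδ' : δ < 40 / 81) (hΔ : 0 < Δ)
    (hrate : β < (1 - 81 / 40 * δ) * discount α Δ ^ 2 * α) {k : ℕ}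
    (hk : 160 * α * (1 + Δ) / δ ≤ k) {r t : ℝ}
    (ht : t = r + 2 * ((k : ℝ) + 1) /
      ((1 - 41 / 40 * δ) ^ 2 * discount α Δ ^ 2 * (1 - discount α Δ) ^ 2 * α) + Δ)
    (hG : ∀ j, S.Typical α β δ Δ j (t - k / (2 * α) + Δ) (t - Δ)) {tx : Tx}
    (hcred : S.CredibleTx spends tx t)
    (htx : ∃ d, tx ∈ S.txs d ∧ S.publishedAt d ≤ (r : EReal)) :
    S.PermanentTx spends Δ tx t := by
  have hα0 : 0 < α := by linarith
  have hg := discount_pos α Δ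
  have hg1 := discount_lt_one hα0 hΔ
  have hkα : 80 * (1 + Δ) ≤ δ * (k / (2 * α)) := by
    rw [div_le_iff₀ hδ] at hk
    rw [← mul_div_assoc, le_div_iff₀ (by positivity)]
    linarith
  have hkα' : 80 * (1 + Δ) ≤ k / (2 * α) := by
    have : 0 ≤ (k : ℝ) / (2 * α) := by positivity
    nlinarith
  have hW : (k : ℝ) / (2 * α) ≤ 2 * ((k : ℝ) + 1) /
      ((1 - 41 / 40 * δ) ^ 2 * discount α Δ ^ 2 * (1 - discount α Δ) ^ 2 * α) := by
    have hc : 0 < 1 - 41 / 40 * δ := by linarith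
    have h1 : (1 - 41 / 40 * δ) ^ 2 ≤ 1 := pow_le_one₀ hc.le (by linarith)
    have h2 : discount α Δ ^ 2 ≤ 1 := pow_le_one₀ hg.le hg1.le
    have h3 : (1 - discount α Δ) ^ 2 ≤ 1 := pow_le_one₀ (by linarith) (by linarith)
    have h4 : (1 - 41 / 40 * δ) ^ 2 * discount α Δ ^ 2 * (1 - discount α Δ) ^ 2 ≤ 1 :=
      mul_le_one₀ (mul_le_one₀ h1 (by positivity) h2) (by positivity) h3
    have hg1' : 0 < 1 - discount α Δ := by linarith
    apply div_le_div₀ (by positivity) (by linarith [Nat.cast_nonneg (α := ℝ) k]) (by positivity)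
    nlinarith
  obtain ⟨d, hdtx, hdr⟩ := htx
  have hr0 : 0 ≤ r := (hV.minedAt_nonneg d).trans (hV.minedAt_le_of_publishedAt_le hdr)
  -- With this `u`, the left end of the typical interval is exactly `u + Δ`, and `hW` gives `r + Δ ≤
  -- u`.
  refine permanentTx_of_credibleTx hV hΔ hm (r := r) (u := t - k / (2 * α)) (by linarith)
    (by linarith) (fun j s T hs hs' hT => ?_) (fun s hs hsr => ?_) hcred ⟨d, hdtx, hdr⟩
  · exact (hG j).numAdversarial_lt_of_long hα0 hδ hδ' hΔ hrate
      (by nlinarith [mul_pos hδ hΔ]) hs hs' hT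
  · refine (hG 0).numAdversarial_lt_of_early hV hα0 hδ hδ' hΔ hrate (k := k) (Nat.cast_nonneg k)
      ?_ hs (by linarith) (by linarith)
    field_simp
    ring

end PrismOutcome

/-! ### Independent gap sequences, analysed by splitting off the first gap. -/

section Sequences

/-- The sequence `x, y 0, y 1, …`. -/
def consSeq (x : ℝ) (y : ℕ → ℝ) : ℕ → ℝ
  | 0 => x
  | n + 1 => y n

@[simp] theorem consSeq_zero (x : ℝ) (y : ℕ → ℝ) : consSeq x y 0 = x := rfl

@[simp] theorem consSeq_succ (x : ℝ) (y : ℕ → ℝ) (n : ℕ) : consSeq x y (n + 1) = y n := rfl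

theorem sum_range_succ_consSeq (x : ℝ) (y : ℕ → ℝ) (n : ℕ) :
    ∑ l ∈ Finset.range (n + 1), consSeq x y l = x + ∑ l ∈ Finset.range n, y l := by
  rw [Finset.sum_range_succ', add_comm]
  rfl

theorem Measurable.consSeq {Ω : Type*} [MeasurableSpace Ω] {f : Ω → ℝ} {g : Ω → ℕ → ℝ}
    (hf : Measurable f) (hg : Measurable g) : Measurable fun ω => consSeq (f ω) (g ω) := by
  refine measurable_pi_iff.mpr fun n => ?_
  rcases n with _ | n
  · exact hf
  · exact (measurable_pi_apply n).comp hg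

/-- The law of a sequence of independent random variables with common law `μ`. -/
noncomputable abbrev iidLaw (μ : Measure ℝ) [IsProbabilityMeasure μ] : Measure (ℕ → ℝ) :=
  Measure.infinitePi fun _ => μ

variable {μ : Measure ℝ} [IsProbabilityMeasure μ]

theorem map_consSeq_prod_iidLaw :
    (μ.prod (iidLaw μ)).map (fun p => consSeq p.1 p.2) = iidLaw μ := by
  have hmeas : Measurable fun p : ℝ × (ℕ → ℝ) => consSeq p.1 p.2 :=
    measurable_fst.consSeq measurable_snd
  refine Measure.eq_infinitePi (fun _ => μ) fun s t ht => ?_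
  classical
  obtain ⟨N, hN⟩ := s.exists_nat_subset_range
  have hN' : s ⊆ Finset.range (N + 1) := hN.trans (Finset.range_mono (Nat.le_succ N))
  -- Padding the cylinder to an initial segment of coordinates makes its preimage a product of a set
  -- for the first gap and a cylinder for the others.
  let t' : ℕ → Set ℝ := fun i => if i ∈ s then t i else Set.univ
  have ht' : ∀ i, MeasurableSet (t' i) := by
    intro i
    by_cases hi : i ∈ s
    · simpa [t', hi] using ht i
    · simp [t', hi]
  have hprod : ∏ i ∈ s, μ (t i) = ∏ i ∈ Finset.range (N + 1), μ (t' i) := by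
    rw [← Finset.prod_subset hN' (fun i _ hi => by simp [t', hi])]
    exact Finset.prod_congr rfl fun i hi => by simp [t', hi]
  have hpre : (fun p : ℝ × (ℕ → ℝ) => consSeq p.1 p.2) ⁻¹' Set.pi s t =
      t' 0 ×ˢ Set.pi (Finset.range N) fun i => t' (i + 1) := by
    ext ⟨x, y⟩
    simp only [Set.mem_preimage, Set.mem_pi, Set.mem_prod, Finset.mem_coe, Finset.mem_range]
    constructor
    · intro h
      refine ⟨?_, fun i _ => ?_⟩
      · by_cases hi : 0 ∈ s
        · simpa [t', hi] using h 0 hi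
        · simp [t', hi]
      · by_cases hi : i + 1 ∈ s
        · simpa [t', hi] using h (i + 1) hi
        · simp [t', hi]
    · rintro ⟨h0, h1⟩ i hi
      rcases i with _ | i
      · simpa [t', hi] using h0
      · simpa [t', hi] using h1 i (by have := Finset.mem_range.mp (hN' hi); omega)
  rw [Measure.map_apply hmeas (MeasurableSet.pi s.countable_toSet fun i _ => ht i), hpre,
    Measure.prod_prod, Measure.infinitePi_pi _ fun i _ => ht' (i + 1), hprod,
    Finset.prod_range_succ', mul_comm]

theorem lintegral_iidLaw_consSeq {F : (ℕ → ℝ) → ENNReal} (hF : Measurable F) :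
    ∫⁻ y, F y ∂iidLaw μ = ∫⁻ x, ∫⁻ y, F (consSeq x y) ∂iidLaw μ ∂μ := by
  have hmeas : Measurable fun p : ℝ × (ℕ → ℝ) => consSeq p.1 p.2 :=
    measurable_fst.consSeq measurable_snd
  conv_lhs => rw [← map_consSeq_prod_iidLaw (μ := μ)]
  rw [lintegral_map hF hmeas]
  exact lintegral_prod _ (hF.comp hmeas).aemeasurable

theorem iidLaw_apply_consSeq {B : Set (ℕ → ℝ)} (hB : MeasurableSet B) :
    iidLaw μ B = ∫⁻ x, iidLaw μ {y | consSeq x y ∈ B} ∂μ := by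
  have hmeas : Measurable fun p : ℝ × (ℕ → ℝ) => consSeq p.1 p.2 :=
    measurable_fst.consSeq measurable_snd
  conv_lhs => rw [← map_consSeq_prod_iidLaw (μ := μ)]
  rw [Measure.map_apply hmeas hB, Measure.prod_apply (hmeas hB)]
  rfl

theorem lintegral_iidLaw_tail {F : (ℕ → ℝ) → ENNReal} (hF : Measurable F) :
    ∫⁻ y, F (fun i => y (i + 1)) ∂iidLaw μ = ∫⁻ y, F y ∂iidLaw μ := by
  have htail : Measurable fun (y : ℕ → ℝ) i => y (i + 1) :=
    measurable_pi_iff.mpr fun i => measurable_pi_apply (i + 1)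
  exact (lintegral_iidLaw_consSeq (hF.comp htail)).trans (by simp)

theorem lintegral_iidLaw_prod {f : ℝ → ENNReal} (hf : Measurable f) (n : ℕ) :
    ∫⁻ y, ∏ l ∈ Finset.range n, f (y l) ∂iidLaw μ = (∫⁻ x, f x ∂μ) ^ n := by
  induction n with
  | zero => simp
  | succ n ih =>
    have hm : ∀ n, Measurable fun y : ℕ → ℝ => ∏ l ∈ Finset.range n, f (y l) := fun n =>
      Finset.measurable_fun_prod _ fun l _ => hf.comp (measurable_pi_apply l)
    rw [lintegral_iidLaw_consSeq (hm _)]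
    simp_rw [Finset.prod_range_succ', consSeq_succ, consSeq_zero]
    simp_rw [lintegral_mul_const _ (hm n), ih]
    rw [lintegral_const_mul _ hf, pow_succ]

theorem lintegral_iidLaw_prod_pair {f : ℝ → ℝ → ENNReal} (hf : Measurable (Function.uncurry f))
    (q : ℕ) : ∫⁻ y, ∏ l ∈ Finset.range q, f (y (2 * l)) (y (2 * l + 1)) ∂iidLaw μ =
      (∫⁻ x, ∫⁻ x', f x x' ∂μ ∂μ) ^ q := by
  induction q with
  | zero => simp
  | succ q ih =>
    have hm : ∀ q, Measurable fun y : ℕ → ℝ =>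
        ∏ l ∈ Finset.range q, f (y (2 * l)) (y (2 * l + 1)) := fun q =>
      Finset.measurable_fun_prod _ fun l _ => by
        have := hf.comp ((measurable_pi_apply (X := fun _ : ℕ => ℝ) (2 * l)).prodMk
          (measurable_pi_apply (2 * l + 1)))
        exact this
    have hcons : ∀ x, Measurable fun y : ℕ → ℝ => consSeq x y := fun x =>
      measurable_const.consSeq measurable_id
    rw [lintegral_iidLaw_consSeq (hm _)]
    have h1 : ∀ x, ∫⁻ y, ∏ l ∈ Finset.range (q + 1),
        f (consSeq x y (2 * l)) (consSeq x y (2 * l + 1)) ∂iidLaw μ =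
        (∫⁻ x, ∫⁻ x', f x x' ∂μ ∂μ) ^ q * ∫⁻ x', f x x' ∂μ := by
      intro x
      refine (lintegral_iidLaw_consSeq ((hm (q + 1)).comp (hcons x))).trans ?_
      simp only [Function.comp_def]
      simp_rw [Finset.prod_range_succ', show ∀ l, 2 * (l + 1) = 2 * l + 1 + 1 from fun l => by ring,
        mul_zero, zero_add, consSeq_succ, consSeq_zero]
      simp_rw [lintegral_mul_const _ (hm q), ih]
      exact lintegral_const_mul _ (hf.comp (measurable_const.prodMk measurable_id))
    simp_rw [h1]
    rw [lintegral_const_mul _ hf.lintegral_prod_right, pow_succ]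

end Sequences

/-! ### Exponential variables: lack of memory and moment generating function. -/

section Exponential

variable {α : ℝ}

theorem lintegral_expMeasure {f : ℝ → ENNReal} (hf : Measurable f) :
    ∫⁻ x, f x ∂expMeasure α = ∫⁻ x, exponentialPDF α x * f x := by
  have hm : Measurable (exponentialPDF α) := (measurable_exponentialPDFReal α).ennreal_ofReal
  have : expMeasure α = volume.withDensity (exponentialPDF α) := rfl
  rw [this, lintegral_withDensity_eq_lintegral_mul _ hm hf]
  rfl

theorem lintegral_expMeasure_sub {f : ℝ → ENNReal} (hf : Measurable f) {c : ℝ} (hc : 0 ≤ c) :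
    ∫⁻ x in Set.Ioi c, f (x - c) ∂expMeasure α =
      ENNReal.ofReal (Real.exp (-(α * c))) * ∫⁻ x, f x ∂expMeasure α := by
  have hm : Measurable (exponentialPDF α) := (measurable_exponentialPDFReal α).ennreal_ofReal
  have hf' : Measurable fun x => f (x - c) := hf.comp (measurable_id.sub_const c)
  rw [← lintegral_indicator measurableSet_Ioi,
    lintegral_expMeasure (hf'.indicator measurableSet_Ioi), lintegral_expMeasure hf,
    ← lintegral_const_mul _ (f := fun x => exponentialPDF α x * f x) (hm.mul hf), ← lintegral_add_right_eq_self _ c]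
  refine lintegral_congr_ae ?_
  -- After the shift by `c`, the two integrands can differ only at 0, where the density is nonzero
  -- but the open ray is not entered.
  filter_upwards [show ∀ᵐ x : ℝ, x ≠ 0 by simp [ae_iff]] with x hx
  rcases lt_or_gt_of_ne hx with hx | hx
  · rw [exponentialPDF_of_neg hx, Set.indicator_of_notMem (by simp [hx.le])]
    simp
  · rw [exponentialPDF_of_nonneg hx.le, exponentialPDF_of_nonneg (by linarith),
      Set.indicator_of_mem (by simpa using hx), add_sub_cancel_right, ← mul_assoc,
      ← ENNReal.ofReal_mul (Real.exp_pos _).le]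
    congr 2
    rw [mul_left_comm, ← Real.exp_add]
    congr 2
    ring

theorem expMeasure_Ioi (hα : 0 < α) {c : ℝ} (hc : 0 ≤ c) :
    expMeasure α (Set.Ioi c) = ENNReal.ofReal (Real.exp (-(α * c))) := by
  have := isProbabilityMeasure_expMeasure hα
  have h := lintegral_expMeasure_sub (α := α) (f := fun _ => 1) measurable_const hc
  simpa using h

/-- Tilting turns the density of rate α into exp φ times that of rate α exp(-φ). Parametrising by φ
makes the moment exactly exp φ, for either sign of φ. -/
theorem lintegral_exp_expMeasure (hα : 0 < α) (φ : ℝ) :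
    ∫⁻ x, ENNReal.ofReal (Real.exp (α * (1 - Real.exp (-φ)) * x)) ∂expMeasure α =
      ENNReal.ofReal (Real.exp φ) := by
  rw [lintegral_expMeasure (by fun_prop)]
  have hα' : 0 < α * Real.exp (-φ) := mul_pos hα (Real.exp_pos _)
  rw [← mul_one (ENNReal.ofReal (Real.exp φ)), ← lintegral_exponentialPDF_eq_one hα',
    ← lintegral_const_mul _ (f := exponentialPDF (α * Real.exp (-φ)))
      (measurable_exponentialPDFReal _).ennreal_ofReal]
  refine lintegral_congr fun x => ?_
  rcases lt_or_ge x 0 with hx | hx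
  · rw [exponentialPDF_of_neg hx, exponentialPDF_of_neg hx]
    simp
  · rw [exponentialPDF_of_nonneg hx, exponentialPDF_of_nonneg hx, ← ENNReal.ofReal_mul
      (by positivity), ← ENNReal.ofReal_mul (by positivity)]
    congr 1
    rw [mul_assoc, ← Real.exp_add, show ∀ z, Real.exp φ * (α * Real.exp (-φ) * z) =
      α * (Real.exp φ * Real.exp (-φ) * z) from fun z => by ring, ← Real.exp_add, add_neg_cancel,
      Real.exp_zero, one_mul]
    congr 2
    ring

theorem lintegral_ite_expMeasure (hα : 0 < α) {c u v : ℝ} (hc : 0 ≤ c) (hu : 0 ≤ u) (hv : 0 ≤ v) :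
    ∫⁻ x, (if c < x then ENNReal.ofReal u else ENNReal.ofReal v) ∂expMeasure α =
      ENNReal.ofReal (u * discount α c + v * (1 - discount α c)) := by
  have := isProbabilityMeasure_expMeasure hα
  have hd0 := (discount_pos α c).le
  have hd1 : discount α c ≤ 1 := Real.exp_le_one_iff.mpr (neg_nonpos.mpr (by positivity))
  have hIoi : expMeasure α (Set.Ioi c) = ENNReal.ofReal (discount α c) := expMeasure_Ioi hα hc
  have hIic : expMeasure α (Set.Ioi c)ᶜ = ENNReal.ofReal (1 - discount α c) := by
    rw [prob_compl_eq_one_sub measurableSet_Ioi, hIoi, ENNReal.ofReal_sub _ hd0, ENNReal.ofReal_one]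
  have h1 : ∫⁻ x in Set.Ioi c, (if c < x then ENNReal.ofReal u else ENNReal.ofReal v) ∂expMeasure α =
      ∫⁻ _ in Set.Ioi c, ENNReal.ofReal u ∂expMeasure α :=
    setLIntegral_congr_fun measurableSet_Ioi fun x hx => if_pos hx
  have h2 : ∫⁻ x in (Set.Ioi c)ᶜ, (if c < x then ENNReal.ofReal u else ENNReal.ofReal v)
      ∂expMeasure α = ∫⁻ _ in (Set.Ioi c)ᶜ, ENNReal.ofReal v ∂expMeasure α :=
    setLIntegral_congr_fun measurableSet_Ioi.compl fun x hx => if_neg hx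
  rw [← lintegral_add_compl _ (measurableSet_Ioi (a := c)), h1, h2, setLIntegral_const,
    setLIntegral_const, hIoi, hIic, ← ENNReal.ofReal_mul hu, ← ENNReal.ofReal_mul hv,
    ← ENNReal.ofReal_add (by positivity) (mul_nonneg hv (by linarith))]

end Exponential

/-! ### Restarting the gap sequence at a fixed time. -/

section Crossing

/-- The sequences of gaps that pass level `a` within `n` steps, and for which the overshoot together
with the subsequent gaps forms a sequence in `B`. -/
def crossing (B : Set (ℕ → ℝ)) (n : ℕ) (a : ℝ) : Set (ℕ → ℝ) :=
  {y | ∃ k < n, (∀ i ≤ k, ∑ l ∈ Finset.range i, y l ≤ a) ∧ a < ∑ l ∈ Finset.range (k + 1), y l ∧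
    consSeq (∑ l ∈ Finset.range (k + 1), y l - a) (fun i => y (k + 1 + i)) ∈ B}

theorem crossing_mono (B : Set (ℕ → ℝ)) (a : ℝ) : Monotone fun n => crossing B n a :=
  fun _ _ hnm _ ⟨k, hk, h⟩ => ⟨k, hk.trans_le hnm, h⟩

theorem measurableSet_crossing {B : Set (ℕ → ℝ)} (hB : MeasurableSet B) (n : ℕ) (a : ℝ) :
    MeasurableSet (crossing B n a) := by
  have hs : ∀ i, Measurable fun y : ℕ → ℝ => ∑ l ∈ Finset.range i, y l := fun i => by fun_prop
  have : crossing B n a = ⋃ k, ⋃ (_ : k < n), (⋂ i, ⋂ (_ : i ≤ k),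
      {y | ∑ l ∈ Finset.range i, y l ≤ a}) ∩ {y | a < ∑ l ∈ Finset.range (k + 1), y l} ∩
      (fun y => consSeq (∑ l ∈ Finset.range (k + 1), y l - a) (fun i => y (k + 1 + i))) ⁻¹' B := by
    ext y
    simp only [crossing, Set.mem_ofPred_eq, Set.mem_iUnion, exists_prop, Set.mem_inter_iff,
      Set.mem_iInter, Set.mem_preimage, and_assoc]
  rw [this]
  refine MeasurableSet.iUnion fun k => MeasurableSet.iUnion fun _ => MeasurableSet.inter
    (MeasurableSet.inter (MeasurableSet.iInter fun i => MeasurableSet.iInter fun _ =>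
      measurableSet_le (hs i) measurable_const) (measurableSet_lt measurable_const (hs _))) ?_
  exact (((hs _).sub_const a).consSeq (measurable_pi_iff.mpr fun i => measurable_pi_apply _)) hB

theorem consSeq_mem_crossing {B : Set (ℕ → ℝ)} {n : ℕ} {a x : ℝ} {y : ℕ → ℝ}
    (h : consSeq x y ∈ crossing B (n + 1) a) :
    a < x ∧ consSeq (x - a) y ∈ B ∨ x ≤ a ∧ y ∈ crossing B n (a - x) := by
  obtain ⟨k, hk, hle, hlt, hB⟩ := h
  rw [sum_range_succ_consSeq] at hlt hB
  rcases k with _ | k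
  · left
    rw [Finset.sum_range_zero, add_zero] at hlt hB
    refine ⟨hlt, ?_⟩
    convert hB using 2
    funext i
    rw [zero_add, add_comm, consSeq_succ]
  · right
    refine ⟨by simpa using hle 1 (by omega), k, by omega, fun i hi => ?_, by linarith, ?_⟩
    · have := hle (i + 1) (by omega)
      rw [sum_range_succ_consSeq] at this
      linarith
    · convert hB using 2
      · ring
      · funext i
        rw [show k + 1 + 1 + i = k + 1 + i + 1 by ring, consSeq_succ]

/-- By lack of memory, the gaps after level `a` are again independent and exponential. -/
theorem iidLaw_crossing_le {α : ℝ} (hα : 0 < α) [IsProbabilityMeasure (expMeasure α)]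
    {B : Set (ℕ → ℝ)} (hB : MeasurableSet B) (n : ℕ) {a : ℝ} (ha : 0 ≤ a) :
    iidLaw (expMeasure α) (crossing B n a) ≤ iidLaw (expMeasure α) B := by
  induction n generalizing a with
  | zero => simp [crossing]
  | succ n ih =>
    have hmeas : Measurable fun x => iidLaw (expMeasure α) {y | consSeq x y ∈ B} := by
      have hc : Measurable fun p : ℝ × (ℕ → ℝ) => consSeq p.1 p.2 :=
        measurable_fst.consSeq measurable_snd
      exact measurable_measure_prodMk_left (hc hB)
    rw [iidLaw_apply_consSeq (measurableSet_crossing hB _ _),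
      ← lintegral_add_compl _ (measurableSet_Ioi (a := a))]
    -- If the first gap already passes `a`, its overshoot is again exponential by lack of memory;
    -- otherwise the induction hypothesis applies at the level that remains. Both cases contribute
    -- their own probability times that of `B`.
    have h1 : ∫⁻ x in Set.Ioi a, iidLaw (expMeasure α) {y | consSeq x y ∈ crossing B (n + 1) a} ∂expMeasure α ≤
        expMeasure α (Set.Ioi a) * iidLaw (expMeasure α) B := by
      rw [expMeasure_Ioi hα ha, iidLaw_apply_consSeq hB,
        ← lintegral_expMeasure_sub hmeas ha]
      refine setLIntegral_mono' measurableSet_Ioi fun x hx => measure_mono fun y hy => ?_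
      rcases consSeq_mem_crossing hy with h | h
      · exact h.2
      · exact absurd h.1 (not_le.mpr hx)
    have h2 : ∫⁻ x in (Set.Ioi a)ᶜ, iidLaw (expMeasure α) {y | consSeq x y ∈ crossing B (n + 1) a} ∂expMeasure α ≤
        expMeasure α (Set.Ioi a)ᶜ * iidLaw (expMeasure α) B := by
      rw [mul_comm, ← setLIntegral_const]
      refine setLIntegral_mono' measurableSet_Ioi.compl fun x hx => ?_
      have hx' : x ≤ a := not_lt.mp hx
      refine (measure_mono fun y hy => ?_).trans (ih (sub_nonneg.mpr hx'))
      rcases consSeq_mem_crossing hy with h | h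
      · exact absurd h.1 hx
      · exact h.2
    refine (add_le_add h1 h2).trans ?_
    rw [← add_mul, measure_add_measure_compl measurableSet_Ioi, measure_univ, one_mul]

theorem iidLaw_iUnion_crossing_le {α : ℝ} (hα : 0 < α) [IsProbabilityMeasure (expMeasure α)]
    {B : Set (ℕ → ℝ)} (hB : MeasurableSet B) {a : ℝ} (ha : 0 ≤ a) :
    iidLaw (expMeasure α) (⋃ n, crossing B n a) ≤ iidLaw (expMeasure α) B := by
  rw [(crossing_mono B a).measure_iUnion]
  exact iSup_le fun n => iidLaw_crossing_le hα hB n ha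

end Crossing

/-! ### Chernoff bounds for gap sequences. -/

section Chernoff

/-- This follows from exp x ≥ 1 + x + x²/2, because (1 - x + x²/2)(1 + x + x²/2) = 1 + x⁴/4 ≥ 1. -/
theorem exp_neg_le_quadratic {x : ℝ} (hx : 0 ≤ x) : Real.exp (-x) ≤ 1 - x + x ^ 2 / 2 := by
  have h1 := Real.quadratic_le_exp_of_nonneg hx
  have h2 : Real.exp (-x) * Real.exp x = 1 := by rw [← Real.exp_add, neg_add_cancel, Real.exp_zero]
  have h3 : 0 ≤ 1 - x + x ^ 2 / 2 := by nlinarith [sq_nonneg (x - 1)]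
  have h4 : 1 ≤ (1 - x + x ^ 2 / 2) * Real.exp x := by
    nlinarith [mul_le_mul_of_nonneg_left h1 h3, sq_nonneg (x ^ 2)]
  exact le_of_mul_le_mul_right (h2.le.trans h4) (Real.exp_pos x)

theorem exp_le_quadratic {x : ℝ} (hx : 0 ≤ x) (hx1 : x ≤ 1) : Real.exp x ≤ 1 + x + x ^ 2 := by
  have := Real.abs_exp_sub_one_sub_id_le (abs_le.mpr ⟨by linarith, hx1⟩)
  linarith [(abs_le.mp this).2]

variable {Ω : Type*} [MeasurableSpace Ω] {ν : Measure Ω}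

theorem measure_le_ofReal_exp_sub {E : Set Ω} {F : Ω → ENNReal} (hF : Measurable F) {u v : ℝ}
    (hE : ∀ y ∈ E, ENNReal.ofReal (Real.exp u) ≤ F y)
    (hI : ∫⁻ y, F y ∂ν ≤ ENNReal.ofReal (Real.exp v)) :
    ν E ≤ ENNReal.ofReal (Real.exp (v - u)) := by
  have h1 : ENNReal.ofReal (Real.exp u) * ν E ≤ ENNReal.ofReal (Real.exp v) :=
    ((mul_le_mul_right (measure_mono hE) _).trans (mul_meas_ge_le_lintegral hF _)).trans hI
  calc ν E = ENNReal.ofReal (Real.exp (-u)) * (ENNReal.ofReal (Real.exp u) * ν E) := by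
        rw [← mul_assoc, ← ENNReal.ofReal_mul (Real.exp_pos _).le, ← Real.exp_add, neg_add_cancel,
          Real.exp_zero, ENNReal.ofReal_one, one_mul]
    _ ≤ ENNReal.ofReal (Real.exp (-u)) * ENNReal.ofReal (Real.exp v) := mul_le_mul_right h1 _
    _ = ENNReal.ofReal (Real.exp (v - u)) := by
        rw [← ENNReal.ofReal_mul (Real.exp_pos _).le, ← Real.exp_add]
        congr 2
        ring

theorem measurable_card_filter {Z : ℕ → Ω → Prop} [∀ l y, Decidable (Z l y)]
    (hZ : ∀ l, MeasurableSet {y | Z l y}) (q : ℕ) :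
    Measurable fun y => (((Finset.range q).filter fun l => Z l y).card : ℝ) := by
  simp_rw [Finset.card_filter]
  push_cast
  exact Finset.measurable_fun_sum _ fun l _ => Measurable.ite (hZ l) measurable_const measurable_const

/-- The lower tail of a binomial variable, which is given by its generating function. -/
theorem measure_card_filter_le {Z : ℕ → Ω → Prop} [∀ l y, Decidable (Z l y)]
    (hZ : ∀ l, MeasurableSet {y | Z l y}) {q : ℕ}
    {p ε : ℝ} (hp : 0 ≤ p) (hε : 0 ≤ ε)
    (hgen : ∀ w, 0 ≤ w → ∫⁻ y, ∏ l ∈ Finset.range q, (if Z l y then ENNReal.ofReal w else 1) ∂ν =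
      ENNReal.ofReal (w * p + (1 - p)) ^ q) :
    ν {y | (((Finset.range q).filter fun l => Z l y).card : ℝ) ≤ (1 - ε) * (q * p)} ≤
      ENNReal.ofReal (Real.exp (-(ε ^ 2 * (q * p) / 2))) := by
  have hF : Measurable fun y =>
      ∏ l ∈ Finset.range q, (if Z l y then ENNReal.ofReal (Real.exp (-ε)) else 1) :=
    Finset.measurable_fun_prod _ fun l _ => Measurable.ite (hZ l) measurable_const measurable_const
  refine (measure_le_ofReal_exp_sub hF (u := -(ε * ((1 - ε) * (q * p))))
    (v := q * (-(p * (ε - ε ^ 2 / 2)))) (fun y hy => ?_) ?_).trans (le_of_eq ?_)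
  · rw [Finset.prod_ite, Finset.prod_const_one, mul_one, Finset.prod_const,
      ← ENNReal.ofReal_pow (Real.exp_pos _).le, ← Real.exp_nat_mul]
    refine ENNReal.ofReal_le_ofReal (Real.exp_le_exp.mpr ?_)
    have : (((Finset.range q).filter fun l => Z l y).card : ℝ) ≤ (1 - ε) * (q * p) := hy
    nlinarith
  · rw [hgen _ (Real.exp_pos _).le, Real.exp_nat_mul, ENNReal.ofReal_pow (Real.exp_pos _).le]
    refine pow_le_pow_left' (ENNReal.ofReal_le_ofReal ?_) q
    have h1 := mul_le_mul_of_nonneg_right (exp_neg_le_quadratic hε) hp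
    have h2 := Real.add_one_le_exp (-(p * (ε - ε ^ 2 / 2)))
    linarith
  · congr 2
    ring

end Chernoff

section Arrivals

theorem discount_le_one {α Δ : ℝ} (hα : 0 < α) (hΔ : 0 ≤ Δ) : discount α Δ ≤ 1 :=
  Real.exp_le_one_iff.mpr (neg_nonpos.mpr (by positivity))

variable {α δ Δ : ℝ} [IsProbabilityMeasure (expMeasure α)]

theorem measurable_exp_mul (c : ℝ) : Measurable fun x : ℝ => ENNReal.ofReal (Real.exp (c * x)) := by
  fun_prop

theorem iidLaw_sum_exp_eq (hα : 0 < α) (φ : ℝ) (n : ℕ) :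
    ∫⁻ y, ENNReal.ofReal (Real.exp (α * (1 - Real.exp (-φ)) * ∑ l ∈ Finset.range n, y l))
      ∂iidLaw (expMeasure α) = ENNReal.ofReal (Real.exp (n * φ)) := by
  rw [Real.exp_nat_mul, ENNReal.ofReal_pow (Real.exp_pos _).le, ← lintegral_exp_expMeasure hα φ,
    ← lintegral_iidLaw_prod (measurable_exp_mul _)]
  refine lintegral_congr fun y => ?_
  rw [Finset.mul_sum, Real.exp_sum, ENNReal.ofReal_prod_of_nonneg fun _ _ => (Real.exp_pos _).le]

theorem iidLaw_lt_sum_le (hα : 0 < α) {φ : ℝ} (hφ : 0 ≤ φ) (ℓ : ℝ) (n : ℕ) :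
    iidLaw (expMeasure α) {y | ℓ < ∑ l ∈ Finset.range n, y l} ≤
      ENNReal.ofReal (Real.exp (n * φ - α * (1 - Real.exp (-φ)) * ℓ)) := by
  refine measure_le_ofReal_exp_sub (by fun_prop) (fun y hy => ?_) (iidLaw_sum_exp_eq hα φ n).le
  refine ENNReal.ofReal_le_ofReal (Real.exp_le_exp.mpr (mul_le_mul_of_nonneg_left (le_of_lt hy) ?_))
  exact mul_nonneg hα.le (sub_nonneg.mpr (Real.exp_le_one_iff.mpr (neg_nonpos.mpr hφ)))

theorem iidLaw_sum_le_le (hα : 0 < α) {φ : ℝ} (hφ : 0 ≤ φ) (ℓ : ℝ) (n : ℕ) :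
    iidLaw (expMeasure α) {y | ∑ l ∈ Finset.range n, y l ≤ ℓ} ≤
      ENNReal.ofReal (Real.exp (α * (Real.exp φ - 1) * ℓ - n * φ)) := by
  refine (measure_le_ofReal_exp_sub (u := α * (1 - Real.exp (- -φ)) * ℓ) (by fun_prop)
    (fun y hy => ?_) (iidLaw_sum_exp_eq hα (-φ) n).le).trans (le_of_eq ?_)
  · refine ENNReal.ofReal_le_ofReal (Real.exp_le_exp.mpr (mul_le_mul_of_nonpos_left hy ?_))
    rw [neg_neg]
    exact mul_nonpos_of_nonneg_of_nonpos hα.le (sub_nonpos.mpr (Real.one_le_exp hφ))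
  · rw [neg_neg]
    congr 2
    ring

/-- The number of gaps longer than `Δ` among `q` gaps, not counting the initial one. -/
noncomputable def longGaps (Δ : ℝ) (q : ℕ) (y : ℕ → ℝ) : ℕ :=
  ((Finset.range q).filter fun l => Δ < y (l + 1)).card

/-- The number of pairs of gaps longer than `Δ` among `q` disjoint pairs of consecutive gaps, the
first of which has the index `o`. -/
noncomputable def longPairs (Δ : ℝ) (o q : ℕ) (y : ℕ → ℝ) : ℕ :=
  ((Finset.range q).filter fun l => Δ < y (2 * l + o) ∧ Δ < y (2 * l + 1 + o)).card

theorem measurableSet_lt_apply (Δ : ℝ) (i : ℕ) : MeasurableSet {y : ℕ → ℝ | Δ < y i} :=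
  measurableSet_lt measurable_const (measurable_pi_apply i)

theorem measurableSet_lt_apply_and (Δ : ℝ) (i k : ℕ) :
    MeasurableSet {y : ℕ → ℝ | Δ < y i ∧ Δ < y k} :=
  (measurableSet_lt_apply Δ i).inter (measurableSet_lt_apply Δ k)

theorem measurable_longGaps (Δ : ℝ) (q : ℕ) : Measurable fun y => (longGaps Δ q y : ℝ) :=
  measurable_card_filter (Z := fun l (y : ℕ → ℝ) => Δ < y (l + 1))
    (fun l => measurableSet_lt_apply Δ (l + 1)) q

theorem measurable_longPairs (Δ : ℝ) (o q : ℕ) : Measurable fun y => (longPairs Δ o q y : ℝ) :=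
  measurable_card_filter (Z := fun l (y : ℕ → ℝ) => Δ < y (2 * l + o) ∧ Δ < y (2 * l + 1 + o))
    (fun l => measurableSet_lt_apply_and Δ (2 * l + o) (2 * l + 1 + o)) q

theorem iidLaw_longGaps_le (hα : 0 < α) (hΔ : 0 ≤ Δ) {ε : ℝ} (hε : 0 ≤ ε) (q : ℕ) :
    iidLaw (expMeasure α) {y | (longGaps Δ q y : ℝ) ≤ (1 - ε) * (q * discount α Δ)} ≤
      ENNReal.ofReal (Real.exp (-(ε ^ 2 * (q * discount α Δ) / 2))) := by
  refine measure_card_filter_le (Z := fun l (y : ℕ → ℝ) => Δ < y (l + 1))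
    (fun l => measurableSet_lt_apply Δ (l + 1)) (discount_pos α Δ).le hε
    fun w hw => ?_
  have hf : Measurable fun x : ℝ => if Δ < x then ENNReal.ofReal w else ENNReal.ofReal 1 :=
    Measurable.ite measurableSet_Ioi measurable_const measurable_const
  have h := lintegral_iidLaw_prod (μ := expMeasure α) hf q
  rw [lintegral_ite_expMeasure hα hΔ hw zero_le_one, one_mul, ENNReal.ofReal_one] at h
  rw [← h]
  exact lintegral_iidLaw_tail
    (F := fun y => ∏ l ∈ Finset.range q, if Δ < y l then ENNReal.ofReal w else 1)
    (Finset.measurable_fun_prod _ fun l _ =>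
      Measurable.ite (measurableSet_lt_apply Δ l) measurable_const measurable_const)

theorem lintegral_iidLaw_shift {F : (ℕ → ℝ) → ENNReal} (hF : Measurable F) (o : ℕ) :
    ∫⁻ y, F (fun i => y (i + o)) ∂iidLaw (expMeasure α) = ∫⁻ y, F y ∂iidLaw (expMeasure α) := by
  induction o with
  | zero => rfl
  | succ o ih =>
    have hs : Measurable fun (y : ℕ → ℝ) i => y (i + o) :=
      measurable_pi_iff.mpr fun i => measurable_pi_apply (i + o)
    rw [← ih]
    refine Eq.trans ?_ (lintegral_iidLaw_tail (hF.comp hs))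
    simp only [Nat.add_assoc]

/-- A loner needs long gaps on both sides, and neighbouring loners share a gap. Disjoint pairs
restore independence, each succeeding with probability g²; the offsets 1 and 2 together cover all
candidates. -/
theorem iidLaw_longPairs_le (hα : 0 < α) (hΔ : 0 ≤ Δ) {ε : ℝ} (hε : 0 ≤ ε) (o q : ℕ) :
    iidLaw (expMeasure α) {y | (longPairs Δ o q y : ℝ) ≤ (1 - ε) * (q * discount α Δ ^ 2)} ≤
      ENNReal.ofReal (Real.exp (-(ε ^ 2 * (q * discount α Δ ^ 2) / 2))) := by
  have hg := (discount_pos α Δ).le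
  have hg1 := discount_le_one hα hΔ
  refine measure_card_filter_le (Z := fun l (y : ℕ → ℝ) => Δ < y (2 * l + o) ∧ Δ < y (2 * l + 1 + o))
    (fun l => measurableSet_lt_apply_and Δ (2 * l + o) (2 * l + 1 + o)) (by positivity) hε
    fun w hw => ?_
  let f : ℝ → ℝ → ENNReal := fun x x' => if Δ < x ∧ Δ < x' then ENNReal.ofReal w else 1
  have hf : Measurable (Function.uncurry f) :=
    Measurable.ite ((measurableSet_lt measurable_const measurable_fst).inter
      (measurableSet_lt measurable_const measurable_snd)) measurable_const measurable_const
  have hin : ∀ x, ∫⁻ x', f x x' ∂expMeasure α =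
      if Δ < x then ENNReal.ofReal (w * discount α Δ + 1 * (1 - discount α Δ))
        else ENNReal.ofReal 1 := by
    intro x
    rw [← lintegral_ite_expMeasure hα hΔ hw zero_le_one]
    by_cases hx : Δ < x
    · simp [f, hx]
    · simp [f, hx]
  have h := lintegral_iidLaw_prod_pair (μ := expMeasure α) hf q
  simp_rw [hin] at h
  rw [lintegral_ite_expMeasure hα hΔ (add_nonneg (mul_nonneg hw hg) (by linarith)) zero_le_one] at h
  rw [show w * discount α Δ ^ 2 + (1 - discount α Δ ^ 2) =
    (w * discount α Δ + 1 * (1 - discount α Δ)) * discount α Δ + 1 * (1 - discount α Δ) by ring,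
    ← h]
  refine lintegral_iidLaw_shift
    (F := fun y => ∏ l ∈ Finset.range q, f (y (2 * l)) (y (2 * l + 1))) ?_ o
  refine Finset.measurable_fun_prod _ fun l _ => ?_
  have := hf.comp ((measurable_pi_apply (X := fun _ : ℕ => ℝ) (2 * l)).prodMk
    (measurable_pi_apply (2 * l + 1)))
  exact this

/-- The gap sequences with too few arrivals, or too few isolated ones, in a time of length `ℓ`. -/
def slowSet (α δ Δ ℓ : ℝ) (n q : ℕ) : Set (ℕ → ℝ) :=
  {y | ℓ < ∑ l ∈ Finset.range n, y l} ∪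
  {y | (longGaps Δ (2 * q) y : ℝ) ≤ (1 - 19 / 40 * δ) * ((2 * q : ℕ) * discount α Δ)} ∪
  {y | (longPairs Δ 1 q y : ℝ) ≤ (1 - 19 / 40 * δ) * (q * discount α Δ ^ 2)} ∪
  {y | (longPairs Δ 2 q y : ℝ) ≤ (1 - 19 / 40 * δ) * (q * discount α Δ ^ 2)}

theorem measurableSet_slowSet (α δ Δ ℓ : ℝ) (n q : ℕ) : MeasurableSet (slowSet α δ Δ ℓ n q) := by
  refine MeasurableSet.union (MeasurableSet.union (MeasurableSet.union ?_ ?_) ?_) ?_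
  · exact measurableSet_lt measurable_const (by fun_prop)
  · exact measurableSet_le (measurable_longGaps _ _) measurable_const
  · exact measurableSet_le (measurable_longPairs _ _ _) measurable_const
  · exact measurableSet_le (measurable_longPairs _ _ _) measurable_const

theorem measurableSet_sum_le (ℓ : ℝ) (n : ℕ) :
    MeasurableSet {y : ℕ → ℝ | ∑ l ∈ Finset.range n, y l ≤ ℓ} :=
  measurableSet_le (by fun_prop) measurable_const

theorem iidLaw_slowSet_le (hα : 0 < α) (hδ : 0 < δ) (hδ' : δ < 40 / 81) (hΔ : 0 ≤ Δ) {ℓ : ℝ}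
    (hℓ : 0 ≤ ℓ) {n q : ℕ} (hn : (n : ℝ) ≤ (1 - 17 / 40 * δ) * (α * ℓ))
    (hq : (1 - δ / 2) * (α * ℓ) ≤ 2 * q) :
    iidLaw (expMeasure α) (slowSet α δ Δ ℓ n q) ≤
      4 * ENNReal.ofReal (Real.exp (-(etaParam α δ Δ / 27 * ℓ))) := by
  have hg := discount_pos α Δ
  have hg1 := discount_le_one hα hΔ
  have hε : 0 ≤ 19 / 40 * δ := by linarith
  have hA : 0 ≤ α * ℓ := by positivity
  have hη : etaParam α δ Δ / 27 * ℓ = δ ^ 2 * (discount α Δ ^ 2 * (α * ℓ)) / 27 := by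
    rw [etaParam]; ring
  have hq' : 3 / 8 * (α * ℓ) ≤ q := by nlinarith
  have h4 : ∀ a b c d : ENNReal, ∀ e, a ≤ e → b ≤ e → c ≤ e → d ≤ e → a + b + c + d ≤ 4 * e := by
    intro a b c d e ha hb hc hd
    calc a + b + c + d ≤ e + e + e + e := add_le_add (add_le_add (add_le_add ha hb) hc) hd
      _ = 4 * e := by ring
  -- The pairs give the tightest of these bounds: (19/40)² · (3/8) / 2 is just above 1/27.
  have hpair : δ ^ 2 * (discount α Δ ^ 2 * (α * ℓ)) / 27 ≤
      (19 / 40 * δ) ^ 2 * (q * discount α Δ ^ 2) / 2 := by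
    have := mul_le_mul_of_nonneg_left hq'
      (show 0 ≤ δ ^ 2 * discount α Δ ^ 2 by positivity)
    have h0 : 0 ≤ δ ^ 2 * (discount α Δ ^ 2 * (α * ℓ)) := by positivity
    nlinarith
  refine (((measure_union_le _ _).trans (add_le_add_left ((measure_union_le _ _).trans
    (add_le_add_left (measure_union_le _ _) _)) _))).trans (h4 _ _ _ _ _ ?_ ?_ ?_ ?_)
  · refine (iidLaw_lt_sum_le hα (φ := 17 / 40 * δ) (by linarith) ℓ n).trans
      (ENNReal.ofReal_le_ofReal (Real.exp_le_exp.mpr ?_))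
    have h1 := exp_neg_le_quadratic (x := 17 / 40 * δ) (by linarith)
    have h2 := mul_le_mul_of_nonneg_right hn (show 0 ≤ 17 / 40 * δ by linarith)
    have h3 := mul_le_mul_of_nonneg_right h1 hA
    have h5 : δ ^ 2 * (discount α Δ ^ 2 * (α * ℓ)) ≤ δ ^ 2 * (α * ℓ) :=
      mul_le_mul_of_nonneg_left (mul_le_of_le_one_left hA (pow_le_one₀ hg.le hg1)) (by positivity)
    have h0 : 0 ≤ δ ^ 2 * (α * ℓ) := by positivity
    rw [hη]
    nlinarith
  · refine (iidLaw_longGaps_le hα hΔ hε (2 * q)).trans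
      (ENNReal.ofReal_le_ofReal (Real.exp_le_exp.mpr ?_))
    have h1 : (q : ℝ) * discount α Δ ^ 2 ≤ (2 * q : ℕ) * discount α Δ := by
      push_cast
      have : (q : ℝ) * discount α Δ * discount α Δ ≤ q * discount α Δ :=
        mul_le_of_le_one_right (by positivity) hg1
      have : 0 ≤ (q : ℝ) * discount α Δ := by positivity
      nlinarith
    have h2 := mul_le_mul_of_nonneg_left h1 (sq_nonneg (19 / 40 * δ))
    rw [hη]
    linarith
  all_goals
    refine (iidLaw_longPairs_le hα hΔ hε _ q).trans
      (ENNReal.ofReal_le_ofReal (Real.exp_le_exp.mpr ?_))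
    rw [hη]
    linarith

/-- The window is longer than `ℓ` by 2 because upper bounds are taken on an enclosing window; `80 ≤
δ * ℓ` makes this a relative error of at most δ/40. -/
theorem iidLaw_fast_le (hα : 0 < α) (hδ : 0 < δ) (hδ' : δ < 40 / 81) (hΔ : 0 ≤ Δ) {ℓ : ℝ}
    (hℓ : 80 ≤ δ * ℓ) {n : ℕ} (hn : (1 + δ) * (α * ℓ) ≤ n) :
    iidLaw (expMeasure α) {y | ∑ l ∈ Finset.range n, y l ≤ ℓ + 2} ≤
      ENNReal.ofReal (Real.exp (-(etaParam α δ Δ / 27 * ℓ))) := by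
  have hg := discount_pos α Δ
  have hg1 := discount_le_one hα hΔ
  have hℓ0 : 0 ≤ ℓ := by
    by_contra h
    nlinarith
  have hA : 0 ≤ α * ℓ := by positivity
  refine (iidLaw_sum_le_le hα (φ := δ / 2) (by linarith) (ℓ + 2) n).trans
      (ENNReal.ofReal_le_ofReal (Real.exp_le_exp.mpr ?_))
  have hη : etaParam α δ Δ / 27 * ℓ = δ ^ 2 * (discount α Δ ^ 2 * (α * ℓ)) / 27 := by
    rw [etaParam]; ring
  have h5 : δ ^ 2 * (discount α Δ ^ 2 * (α * ℓ)) ≤ δ ^ 2 * (α * ℓ) :=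
    mul_le_mul_of_nonneg_left (mul_le_of_le_one_left hA (pow_le_one₀ hg.le hg1)) (by positivity)
  have h1 := exp_le_quadratic (x := δ / 2) (by linarith) (by linarith)
  have h2 := mul_le_mul_of_nonneg_right hn (show 0 ≤ δ / 2 by linarith)
  have h3 : α * (ℓ + 2) ≤ (1 + δ / 40) * (α * ℓ) := by nlinarith
  have h4 : (Real.exp (δ / 2) - 1) * (α * (ℓ + 2)) ≤
      (δ / 2 + (δ / 2) ^ 2) * ((1 + δ / 40) * (α * ℓ)) :=
    mul_le_mul (by linarith) h3 (by positivity) (by positivity)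
  have h6 : δ * (δ ^ 2 * (α * ℓ)) ≤ 40 / 81 * (δ ^ 2 * (α * ℓ)) :=
    mul_le_mul_of_nonneg_right hδ'.le (by positivity)
  have h0 : 0 ≤ δ ^ 2 * (α * ℓ) := by positivity
  rw [hη]
  nlinarith

end Arrivals

section ArrivalNumbers

/-- The number of honest arrivals that is expected, up to a relative error, in a time `ℓ`. -/
noncomputable def fewArrivals (α δ ℓ : ℝ) : ℕ := ⌈(1 - 9 / 20 * δ) * (α * ℓ)⌉₊

/-- The number of honest arrivals that is not expected to be exceeded in a time `ℓ`. -/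
noncomputable def manyArrivals (α δ ℓ : ℝ) : ℕ := ⌈(1 + δ) * (α * ℓ)⌉₊

/-- Since α > 1/2, δαℓ ≥ 40, so one block of rounding costs at most δαℓ/40. This turns 9/20 into
17/40 on one side, and into 1/2 on the other, where two blocks are lost. -/
theorem fewArrivals_bounds {α δ : ℝ} (hα : 1 / 2 < α) (hδ' : δ < 40 / 81) {ℓ : ℝ}
    (hℓ0 : 0 < ℓ) (hℓ : 80 ≤ δ * ℓ) :
    (1 - 9 / 20 * δ) * (α * ℓ) ≤ fewArrivals α δ ℓ ∧
      (fewArrivals α δ ℓ : ℝ) ≤ (1 - 17 / 40 * δ) * (α * ℓ) ∧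
      (1 - δ / 2) * (α * ℓ) ≤ 2 * ((fewArrivals α δ ℓ - 1) / 2 : ℕ) ∧
      2 * ((fewArrivals α δ ℓ - 1) / 2) + 1 ≤ fewArrivals α δ ℓ := by
  have hA : 40 ≤ δ * (α * ℓ) := by nlinarith
  have hA' : 40 ≤ α * ℓ := by nlinarith
  have h1 : (1 - 9 / 20 * δ) * (α * ℓ) ≤ fewArrivals α δ ℓ := Nat.le_ceil _
  have h2 : (fewArrivals α δ ℓ : ℝ) < (1 - 9 / 20 * δ) * (α * ℓ) + 1 :=
    Nat.ceil_lt_add_one (mul_nonneg (by linarith) (by linarith))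
  have h3 : 1 ≤ fewArrivals α δ ℓ := by
    have : (0 : ℝ) < fewArrivals α δ ℓ := by nlinarith
    exact_mod_cast this
  have h4 : fewArrivals α δ ℓ ≤ 2 * ((fewArrivals α δ ℓ - 1) / 2) + 2 := by omega
  have h4' : (fewArrivals α δ ℓ : ℝ) ≤ 2 * ((fewArrivals α δ ℓ - 1) / 2 : ℕ) + 2 := by
    exact_mod_cast h4
  exact ⟨h1, by linarith, by linarith, by omega⟩

end ArrivalNumbers

/-! ### Upper tail of the adversarial block count. -/

section PoissonTail

/-- The Chernoff bound for the upper tail of a Poisson variable with mean `M`. -/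
theorem one_sub_poisson_cdf_le {M a φ : ℝ} (hM : 0 ≤ M) (hφ : 0 ≤ φ) :
    1 - Real.exp (-M) * ∑ i ∈ Finset.range (⌊a⌋₊ + 1), M ^ i / (Nat.factorial i : ℝ) ≤
      Real.exp (M * (Real.exp φ - 1) - φ * a) := by
  have hsum : ∀ x : ℝ, HasSum (fun i : ℕ => x ^ i / (Nat.factorial i : ℝ)) (Real.exp x) := by
    intro x
    rw [Real.exp_eq_exp_ℝ]
    exact NormedSpace.expSeries_div_hasSum_exp x
  have h1 := (hsum (M * Real.exp φ)).mul_left (Real.exp (-(φ * a)))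
  have h2 := (hsum M).sub (hasSum_sum_of_ne_finset_zero (f := fun i : ℕ =>
    if i ∈ Finset.range (⌊a⌋₊ + 1) then M ^ i / (Nat.factorial i : ℝ) else 0)
    (s := Finset.range (⌊a⌋₊ + 1)) fun i hi => if_neg hi)
  rw [Finset.sum_congr rfl (g := fun i : ℕ => M ^ i / (Nat.factorial i : ℝ))
    fun i hi => if_pos hi] at h2
  -- The tail series is dominated term by term: beyond `a`, the factor exp(φ(i - a)) is at least 1.
  have h3 := hasSum_le (fun i => ?_) h2 h1
  · have h4 := mul_le_mul_of_nonneg_left h3 (Real.exp_pos (-M)).le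
    have h5 : Real.exp (-M) * Real.exp M = 1 := by
      rw [← Real.exp_add, neg_add_cancel, Real.exp_zero]
    have h6 : Real.exp (-M) * (Real.exp (-(φ * a)) * Real.exp (M * Real.exp φ)) =
        Real.exp (M * (Real.exp φ - 1) - φ * a) := by
      rw [← Real.exp_add, ← Real.exp_add]
      congr 1
      ring
    linarith [mul_sub (Real.exp (-M)) (Real.exp M)
      (∑ i ∈ Finset.range (⌊a⌋₊ + 1), M ^ i / (Nat.factorial i : ℝ))]
  · have hpos : 0 ≤ M ^ i / (Nat.factorial i : ℝ) := by positivity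
    by_cases hi : i ∈ Finset.range (⌊a⌋₊ + 1)
    · rw [if_pos hi, sub_self]
      positivity
    · rw [if_neg hi, sub_zero, mul_pow, ← Real.exp_nat_mul, mul_div_right_comm,
        mul_left_comm, ← Real.exp_add]
      have hia : a ≤ i := by
        rw [Finset.mem_range, not_lt] at hi
        exact (Nat.lt_floor_add_one a).le.trans (by exact_mod_cast hi)
      refine le_mul_of_one_le_right hpos (Real.one_le_exp ?_)
      nlinarith

/-- With φ = δ/2 the first-order terms in β cancel, and β < g²α bounds the second-order ones. The
factor 9/10 in the threshold later makes the bound in `Good` strict. -/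
theorem poisson_tail_le {α β δ Δ ℓ M : ℝ} (hα : 0 < α) (hβ : 0 ≤ β) (hδ : 0 < δ)
    (hδ' : δ < 40 / 81) (hrate : β < discount α Δ ^ 2 * α) (hℓ : 80 ≤ δ * ℓ)
    (hMℓ : M ≤ β * (ℓ + 2)) :
    M * (Real.exp (δ / 2) - 1) - δ / 2 * (ℓ * β + 9 / 10 * (ℓ * discount α Δ ^ 2 * α * δ)) ≤
      -(etaParam α δ Δ / 27 * ℓ) := by
  have hℓ0 : 0 ≤ ℓ := by
    by_contra h
    nlinarith
  have hg := discount_pos α Δ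
  set R := discount α Δ ^ 2 * α with hR
  have hR0 : 0 < R := by positivity
  have hη : etaParam α δ Δ / 27 * ℓ = δ ^ 2 * (R * ℓ) / 27 := by
    rw [etaParam, hR]; ring
  rw [hη, show ℓ * discount α Δ ^ 2 * α * δ = δ * (R * ℓ) by rw [hR]; ring]
  have h1 := exp_le_quadratic (x := δ / 2) (by linarith) (by linarith)
  have h2 : M * (Real.exp (δ / 2) - 1) ≤ β * (ℓ + 2) * (δ / 2 + (δ / 2) ^ 2) :=
    mul_le_mul hMℓ (by linarith) (by linarith [Real.one_le_exp (show 0 ≤ δ / 2 by linarith)])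
      (by positivity)
  have h3 : β * ℓ ≤ R * ℓ := mul_le_mul_of_nonneg_right hrate.le hℓ0
  have h4 : β * (ℓ + 2) ≤ β * ℓ + δ / 40 * (R * ℓ) := by nlinarith
  have h5 : β * (ℓ + 2) * (δ / 2 + (δ / 2) ^ 2) ≤
      (β * ℓ + δ / 40 * (R * ℓ)) * (δ / 2 + (δ / 2) ^ 2) :=
    mul_le_mul_of_nonneg_right h4 (by positivity)
  have h6 : δ ^ 2 * (β * ℓ) ≤ δ ^ 2 * (R * ℓ) := mul_le_mul_of_nonneg_left h3 (by positivity)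
  have h7 : δ * (δ ^ 2 * (R * ℓ)) ≤ 40 / 81 * (δ ^ 2 * (R * ℓ)) :=
    mul_le_mul_of_nonneg_right hδ'.le (by positivity)
  have h0 : 0 ≤ δ ^ 2 * (R * ℓ) := by positivity
  nlinarith

end PoissonTail

/-! ### From gap sequences to block counts. -/

namespace PrismOutcome

section Arrivals

variable {m : ℕ} {Tx : Type*} {S : PrismOutcome m Tx} {α β δ Δ : ℝ} {j : Fin (m + 1)}

/-- The times between consecutive honest `j`-blocks. -/
noncomputable def honestGaps (S : PrismOutcome m Tx) (j : Fin (m + 1)) (i : ℕ) : ℝ :=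
  S.honestArrival j (i + 1) - S.honestArrival j i

theorem Valid.honestArrival_zero (hV : S.Valid Δ) : S.honestArrival j 0 = 0 := by
  rw [honestArrival, Nat.nth_zero_of_zero (hV.honest_genesis j), hV.minedAt_genesis]

/-- If there were finitely many honest blocks, `Nat.nth` would eventually return its default 0, the
genesis block, and the later gaps would vanish. -/
theorem Valid.infinite_honest (hV : S.Valid Δ) (hpos : ∀ i, 0 < S.honestGaps j i) :
    {k | S.honest (j, k)}.Infinite := by
  intro hfin
  have h : ∀ i, hfin.toFinset.card ≤ i → S.honestArrival j i = 0 := fun i hi => by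
    rw [honestArrival, Nat.nth_of_card_le hfin hi, hV.minedAt_genesis]
  have := hpos hfin.toFinset.card
  rw [honestGaps, h _ le_rfl, h _ (Nat.le_succ _), sub_zero] at this
  exact lt_irrefl _ this

theorem strictMono_honestArrival (hpos : ∀ i, 0 < S.honestGaps j i) :
    StrictMono (S.honestArrival j) :=
  strictMono_nat_of_lt_succ fun i => sub_pos.mp (hpos i)

theorem Valid.sum_honestGaps (hV : S.Valid Δ) (n : ℕ) :
    ∑ l ∈ Finset.range n, S.honestGaps j l = S.honestArrival j n := by
  simp only [honestGaps]
  rw [Finset.sum_range_sub, hV.honestArrival_zero, sub_zero]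

/-- The time from `a` to the first honest `j`-block after it, which has the number `k + 1`, followed
by the times between the subsequent honest `j`-blocks. -/
noncomputable def gapsAfter (S : PrismOutcome m Tx) (j : Fin (m + 1)) (a : ℝ) (k : ℕ) : ℕ → ℝ :=
  consSeq (S.honestArrival j (k + 1) - a) fun i => S.honestGaps j (k + 1 + i)

theorem sum_gapsAfter (a : ℝ) (k : ℕ) {n : ℕ} (hn : 1 ≤ n) :
    ∑ l ∈ Finset.range n, S.gapsAfter j a k l = S.honestArrival j (k + n) - a := by
  obtain ⟨n, rfl⟩ := Nat.exists_eq_add_of_le' hn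
  rw [gapsAfter, sum_range_succ_consSeq]
  have : ∑ l ∈ Finset.range n, S.honestGaps j (k + 1 + l) =
      S.honestArrival j (k + 1 + n) - S.honestArrival j (k + 1) :=
    Finset.sum_range_sub (fun l => S.honestArrival j (k + 1 + l)) n
  rw [this, show k + (n + 1) = k + 1 + n by ring]
  ring

/-- Honest arrivals are unbounded, so level `a` is certainly crossed; avoiding all crossing events
then means that the restarted sequence avoids `B`. -/
theorem Valid.exists_gapsAfter_notMem (hV : S.Valid Δ) (hpos : ∀ i, 0 < S.honestGaps j i) {a : ℝ}
    (ha : 0 ≤ a) {B : Set (ℕ → ℝ)} (hB : S.honestGaps j ∉ ⋃ n, crossing B n a) :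
    ∃ k, S.honestArrival j k ≤ a ∧ a < S.honestArrival j (k + 1) ∧ S.gapsAfter j a k ∉ B := by
  have hex : ∃ i, a < S.honestArrival j i := by
    have h1 := (hV.minedAt_tendsto j).comp
      (Nat.nth_strictMono (hV.infinite_honest hpos)).tendsto_atTop
    exact (h1.eventually_gt_atTop a).exists
  have hspec := Nat.find_spec hex
  have hmin : ∀ i < Nat.find hex, S.honestArrival j i ≤ a := fun i hi =>
    not_lt.mp (Nat.find_min hex hi)
  generalize Nat.find hex = i at hspec hmin
  rcases i with _ | k
  · rw [hV.honestArrival_zero] at hspec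
    exact absurd hspec (not_lt.mpr ha)
  refine ⟨k, hmin k (Nat.lt_succ_self k), hspec, fun hmem => hB ?_⟩
  refine Set.mem_iUnion.mpr ⟨k + 1, k, Nat.lt_succ_self k, fun i hi => ?_, ?_, ?_⟩
  · rw [hV.sum_honestGaps]
    exact hmin i (Nat.lt_succ_of_le hi)
  · rwa [hV.sum_honestGaps]
  · rw [hV.sum_honestGaps]
    exact hmem

theorem exists_nth_eq {l : ℕ} (hl : S.honest (j, l)) :
    ∃ i, Nat.nth (fun k => S.honest (j, k)) i = l := by
  classical
  exact ⟨_, Nat.nth_count (p := fun k => S.honest (j, k)) hl⟩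

theorem Valid.lagger_nth (hV : S.Valid Δ) (hpos : ∀ i, 0 < S.honestGaps j i) {i : ℕ}
    (hi : Δ < S.honestGaps j i) :
    S.Lagger Δ j (Nat.nth (fun k => S.honest (j, k)) (i + 1)) := by
  have hmono := strictMono_honestArrival hpos
  refine ⟨Nat.nth_mem_of_infinite (hV.infinite_honest hpos) _, fun l hl h1 h2 => ?_⟩
  obtain ⟨i', rfl⟩ := exists_nth_eq hl
  change S.honestArrival j (i + 1) - Δ ≤ S.honestArrival j i' at h1
  change S.honestArrival j i' ≤ S.honestArrival j (i + 1) at h2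
  have h3 : i' ≤ i + 1 := hmono.le_iff_le.mp h2
  have h4 : i < i' := hmono.lt_iff_lt.mp (by rw [honestGaps] at hi; linarith)
  rw [show i' = i + 1 by omega]

theorem Valid.loner_nth (hV : S.Valid Δ) (hpos : ∀ i, 0 < S.honestGaps j i) {i : ℕ}
    (hi : Δ < S.honestGaps j i) (hi' : Δ < S.honestGaps j (i + 1)) :
    S.Loner Δ j (Nat.nth (fun k => S.honest (j, k)) (i + 1)) := by
  have hmono := strictMono_honestArrival hpos
  refine ⟨hV.lagger_nth hpos hi, fun l hl h1 h2 => ?_⟩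
  obtain ⟨i', rfl⟩ := exists_nth_eq hl
  change S.honestArrival j (i + 1) ≤ S.honestArrival j i' at h1
  change S.honestArrival j i' ≤ S.honestArrival j (i + 1) + Δ at h2
  have h3 : i + 1 ≤ i' := hmono.le_iff_le.mp h1
  have h4 : i' < i + 1 + 1 := hmono.lt_iff_lt.mp (by rw [honestGaps] at hi'; linarith)
  rw [show i' = i + 1 by omega]

theorem Valid.card_le_ncard_of_nth (hV : S.Valid Δ) (hpos : ∀ i, 0 < S.honestGaps j i)
    {a b : ℝ} {Q : ℕ → Prop} (F : Finset ℕ)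
    (hF : ∀ i ∈ F, a < S.honestArrival j i ∧ S.honestArrival j i ≤ b ∧
      Q (Nat.nth (fun k => S.honest (j, k)) i)) :
    F.card ≤ {k ∈ S.minedDuring j a b | Q k}.ncard := by
  rw [← Set.ncard_coe_finset]
  exact Set.ncard_le_ncard_of_injOn _ (fun i hi => ⟨⟨(hF i hi).1, (hF i hi).2.1⟩, (hF i hi).2.2⟩)
    ((Nat.nth_injective (hV.infinite_honest hpos)).injOn)
    ((hV.finite_minedDuring j a b).subset fun _ hk => hk.1)

theorem numHonest_lt (hpos : ∀ i, 0 < S.honestGaps j i) {a b : ℝ} {k n : ℕ}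
    (hk : S.honestArrival j k ≤ a) (hn : 1 ≤ n) (hb : b < S.honestArrival j (k + n)) :
    S.numHonest j a b < n := by
  have hmono := strictMono_honestArrival hpos
  have hsub : {l ∈ S.minedDuring j a b | S.honest (j, l)} ⊆
      (((Finset.Ioo k (k + n)).image (Nat.nth fun k => S.honest (j, k)) : Finset ℕ) : Set ℕ) := by
    rintro l ⟨⟨h1, h2⟩, h3⟩
    obtain ⟨i, rfl⟩ := exists_nth_eq h3
    change a < S.honestArrival j i at h1
    change S.honestArrival j i ≤ b at h2
    exact Finset.mem_coe.mpr (Finset.mem_image_of_mem _ (Finset.mem_Ioo.mpr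
      ⟨hmono.lt_iff_lt.mp (hk.trans_lt h1), hmono.lt_iff_lt.mp (h2.trans_lt hb)⟩))
  have h1 := Set.ncard_le_ncard hsub (Finset.finite_toSet _)
  rw [Set.ncard_coe_finset] at h1
  have h2 := h1.trans Finset.card_image_le
  rw [Nat.card_Ioo] at h2
  rw [numHonest]
  omega

/-- Lower bounds for the numbers of honest blocks, of laggers and of loners. -/
theorem Valid.le_counts_of_gapsAfter (hV : S.Valid Δ) (hpos : ∀ i, 0 < S.honestGaps j i)
    {a a' b : ℝ} {k n q : ℕ} (haa' : a ≤ a') (hk : a' < S.honestArrival j (k + 1))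
    (hqn : 2 * q + 1 ≤ n) (hb : S.honestArrival j (k + n) ≤ b) :
    n ≤ S.numHonest j a b ∧ longGaps Δ (2 * q) (S.gapsAfter j a' k) ≤ S.numLagger Δ j a b ∧
      longPairs Δ 1 q (S.gapsAfter j a' k) + longPairs Δ 2 q (S.gapsAfter j a' k) ≤
        S.numLoner Δ j a b := by
  have hmono := strictMono_honestArrival hpos
  have hbetween : ∀ i, k + 1 ≤ i → i ≤ k + n →
      a < S.honestArrival j i ∧ S.honestArrival j i ≤ b := fun i h1 h2 =>
    ⟨haa'.trans_lt (hk.trans_le (hmono.monotone h1)), (hmono.monotone h2).trans hb⟩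
  have hgap : ∀ i, S.gapsAfter j a' k (i + 1) = S.honestGaps j (k + 1 + i) := fun _ => rfl
  refine ⟨?_, ?_, ?_⟩
  · have := hV.card_le_ncard_of_nth hpos (a := a) (b := b) (Q := fun k => S.honest (j, k))
      (Finset.Ioc k (k + n)) fun i hi => by
        rw [Finset.mem_Ioc] at hi
        obtain ⟨h1, h2⟩ := hbetween i hi.1 hi.2
        exact ⟨h1, h2, Nat.nth_mem_of_infinite (hV.infinite_honest hpos) _⟩
    simpa [numHonest] using this
  · have := hV.card_le_ncard_of_nth hpos (a := a) (b := b) (Q := fun k => S.Lagger Δ j k)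
      (((Finset.range (2 * q)).filter fun l => Δ < S.gapsAfter j a' k (l + 1)).image
        fun l => k + 1 + l + 1) fun i hi => by
        obtain ⟨l, hl, rfl⟩ := Finset.mem_image.mp hi
        obtain ⟨hl, hl'⟩ := Finset.mem_filter.mp hl
        rw [Finset.mem_range] at hl
        obtain ⟨h1, h2⟩ := hbetween (k + 1 + l + 1) (by omega) (by omega)
        exact ⟨h1, h2, hV.lagger_nth hpos (by rwa [hgap] at hl')⟩
    rwa [Finset.card_image_of_injective _ fun x y hxy => by simpa using hxy] at this
  -- The two offsets produce loners at arrival indices of opposite parity relative to `k`, so they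
  -- are not counted twice. The gap after the last loner may end beyond `b`; only the loner itself
  -- must lie in the interval.
  · have := hV.card_le_ncard_of_nth hpos (a := a) (b := b) (Q := fun k => S.Loner Δ j k)
      ((((Finset.range q).filter fun l => Δ < S.gapsAfter j a' k (2 * l + 1) ∧
          Δ < S.gapsAfter j a' k (2 * l + 1 + 1)).image fun l => k + 1 + 2 * l + 1) ∪
        (((Finset.range q).filter fun l => Δ < S.gapsAfter j a' k (2 * l + 2) ∧
          Δ < S.gapsAfter j a' k (2 * l + 1 + 2)).image fun l => k + 1 + (2 * l + 1) + 1))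
      fun i hi => by
        rcases Finset.mem_union.mp hi with hi | hi
        all_goals
          obtain ⟨l, hl, rfl⟩ := Finset.mem_image.mp hi
          obtain ⟨hl, hl1, hl2⟩ := Finset.mem_filter.mp hl
          rw [Finset.mem_range] at hl
          rw [hgap] at hl1 hl2
        · obtain ⟨h1, h2⟩ := hbetween (k + 1 + 2 * l + 1) (by omega) (by omega)
          exact ⟨h1, h2, hV.loner_nth hpos hl1 hl2⟩
        · obtain ⟨h1, h2⟩ := hbetween (k + 1 + (2 * l + 1) + 1) (by omega) (by omega)
          exact ⟨h1, h2, hV.loner_nth hpos hl1 hl2⟩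
    rw [Finset.card_union_of_disjoint, Finset.card_image_of_injective _ fun x y hxy => by
      simpa using hxy, Finset.card_image_of_injective _ fun x y hxy => by simpa using hxy] at this
    · exact this
    · rw [Finset.disjoint_left]
      intro x hx hx'
      obtain ⟨l, -, rfl⟩ := Finset.mem_image.mp hx
      obtain ⟨l', -, h⟩ := Finset.mem_image.mp hx'
      omega

theorem Valid.numAdversarial_mono (hV : S.Valid Δ) {a a' b b' : ℝ} (ha : a' ≤ a) (hb : b ≤ b') :
    S.numAdversarial j a b ≤ S.numAdversarial j a' b' :=
  Set.ncard_le_ncard (fun _ hk => ⟨⟨ha.trans_lt hk.1.1, hk.1.2.trans hb⟩, hk.2⟩)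
    ((hV.finite_minedDuring j a' b').subset fun _ hk => hk.1)

/-- The outcomes violating one of the bounds that ensure good events on all time intervals
that contain `(a', a' + ℓ]` and are contained in `(a'', b'']`. -/
def Atypical (S : PrismOutcome m Tx) (α β δ Δ : ℝ) (j : Fin (m + 1)) (a' ℓ a'' b'' : ℝ) : Prop :=
  S.honestGaps j ∈
      ⋃ n, crossing (slowSet α δ Δ ℓ (fewArrivals α δ ℓ) ((fewArrivals α δ ℓ - 1) / 2)) n a' ∨
    S.honestGaps j ∈
      ⋃ n, crossing {y | ∑ l ∈ Finset.range (manyArrivals α δ ℓ), y l ≤ ℓ + 2} n a'' ∨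
    ℓ * β + 9 / 10 * (ℓ * discount α Δ ^ 2 * α * δ) < S.numAdversarial j a'' b''

/-- Counts are monotone in the interval: lower bounds come from the inner window of length `ℓ`,
upper bounds from the outer one of length at most `ℓ + 2`. The slack in the constants absorbs the
discrepancy. -/
theorem Valid.good_of_not_atypical (hV : S.Valid Δ) (hpos : ∀ i, 0 < S.honestGaps j i)
    (hα : 1 / 2 < α) (hβ : 0 ≤ β) (hδ : 0 < δ) (hδ' : δ < 40 / 81) {a' a'' b'' a b ℓ : ℝ}
    (ha'' : 0 ≤ a'') (haa : a'' ≤ a) (haa' : a ≤ a') (hb : a' + ℓ ≤ b) (hbb : b ≤ b'')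
    (hlen : b'' - a'' ≤ ℓ + 2) (hℓ0 : 0 < ℓ) (hℓ : 80 ≤ δ * ℓ)
    (h : ¬ S.Atypical α β δ Δ j a' ℓ a'' b'') : S.Good α β δ Δ j a b := by
  have hα0 : 0 < α := by linarith
  rw [Atypical, not_or, not_or, not_lt] at h
  obtain ⟨hslow, hfast, hadv⟩ := h
  obtain ⟨k, -, hk, hz⟩ := hV.exists_gapsAfter_notMem hpos (by linarith) hslow
  obtain ⟨k', hk', -, hz'⟩ := hV.exists_gapsAfter_notMem hpos ha'' hfast
  obtain ⟨hn1, -, hq1, hqn⟩ := fewArrivals_bounds hα hδ' hℓ0 hℓ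
  simp only [slowSet, Set.mem_union, Set.mem_ofPred_eq, not_or, not_lt, not_le] at hz hz'
  obtain ⟨⟨⟨hz1, hz2⟩, hz3⟩, hz4⟩ := hz
  generalize (fewArrivals α δ ℓ - 1) / 2 = q at *
  generalize fewArrivals α δ ℓ = n at *
  rw [sum_gapsAfter _ _ (by omega)] at hz1
  obtain ⟨hN, hX, hY⟩ := hV.le_counts_of_gapsAfter hpos haa' hk hqn (b := b) (by linarith)
  have hA : 40 ≤ δ * (α * ℓ) := by nlinarith
  have hA0 : 0 < α * ℓ := by positivity
  have hmany : (1 + δ) * (α * ℓ) ≤ manyArrivals α δ ℓ := Nat.le_ceil _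
  have hmany' : (manyArrivals α δ ℓ : ℝ) < (1 + δ) * (α * ℓ) + 1 :=
    Nat.ceil_lt_add_one (by positivity)
  have hmany1 : 1 ≤ manyArrivals α δ ℓ := by
    have : (0 : ℝ) < manyArrivals α δ ℓ := lt_of_lt_of_le (by positivity) hmany
    exact_mod_cast this
  rw [sum_gapsAfter _ _ hmany1] at hz'
  have hNlt := numHonest_lt hpos (a := a) (b := b) (hk'.trans haa) hmany1 (by linarith)
  have hN' : (n : ℝ) ≤ S.numHonest j a b := by exact_mod_cast hN
  have hX' : (longGaps Δ (2 * q) (S.gapsAfter j a' k) : ℝ) ≤ S.numLagger Δ j a b := by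
    exact_mod_cast hX
  have hY' : (longPairs Δ 1 q (S.gapsAfter j a' k) : ℝ) + longPairs Δ 2 q (S.gapsAfter j a' k) ≤
      S.numLoner Δ j a b := by exact_mod_cast hY
  have hZ' : (S.numAdversarial j a b : ℝ) ≤ S.numAdversarial j a'' b'' := by
    exact_mod_cast hV.numAdversarial_mono haa hbb
  have hNlt' : (S.numHonest j a b : ℝ) + 1 ≤ manyArrivals α δ ℓ := by exact_mod_cast hNlt
  have hba : (1 - δ) * (b - a) * α ≤ (1 - 39 / 40 * δ) * (α * ℓ) := by
    have h0 := mul_le_mul_of_nonneg_left hℓ hα0.le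
    have h1 := mul_le_mul_of_nonneg_left (show b - a ≤ ℓ + 2 by linarith) hα0.le
    have h2 : α * (b - a) ≤ (1 + δ / 40) * (α * ℓ) := by linarith
    have h3 := mul_le_mul_of_nonneg_left h2 (show 0 ≤ 1 - δ by linarith)
    have h4 : 0 ≤ δ * (δ * (α * ℓ)) := by positivity
    linarith
  have hq2 : (1 - δ) * (b - a) * α ≤ (1 - 19 / 40 * δ) * (2 * q) := by
    have h2 := mul_le_mul_of_nonneg_left hq1 (show 0 ≤ 1 - 19 / 40 * δ by linarith)
    have h3 : 0 ≤ δ * (δ * (α * ℓ)) := by positivity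
    linarith
  have hg := discount_pos α Δ
  refine ⟨⟨?_, ?_⟩, ?_, ?_, ?_⟩
  · have : 0 < δ * (α * ℓ) := by positivity
    linarith
  · have : (1 + δ) * (α * ℓ) ≤ (1 + δ) * (b - a) * α := by
      have h1 : α * ℓ ≤ α * (b - a) := mul_le_mul_of_nonneg_left (by linarith) hα0.le
      linarith [mul_le_mul_of_nonneg_left h1 (show 0 ≤ 1 + δ by linarith)]
    linarith
  · have h1 := mul_le_mul_of_nonneg_right hq2 hg.le
    push_cast at hz2
    calc (1 - δ) * (b - a) * discount α Δ * α = (1 - δ) * (b - a) * α * discount α Δ := by ring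
      _ ≤ (1 - 19 / 40 * δ) * (2 * q * discount α Δ) := by linarith
      _ < _ := hz2.trans_le hX'
  · have h1 := mul_le_mul_of_nonneg_right hq2 (sq_nonneg (discount α Δ))
    calc (1 - δ) * (b - a) * discount α Δ ^ 2 * α
        = (1 - δ) * (b - a) * α * discount α Δ ^ 2 := by ring
      _ ≤ (1 - 19 / 40 * δ) * (q * discount α Δ ^ 2) +
          (1 - 19 / 40 * δ) * (q * discount α Δ ^ 2) := by linarith
      _ < _ := (add_lt_add hz3 hz4).trans_le hY'
  · have h1 : ℓ * β ≤ (b - a) * β := mul_le_mul_of_nonneg_right (by linarith) hβ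
    have h0 : 0 < discount α Δ ^ 2 * α * δ := by positivity
    have h2 : ℓ * (discount α Δ ^ 2 * α * δ) ≤ (b - a) * (discount α Δ ^ 2 * α * δ) :=
      mul_le_mul_of_nonneg_right (by linarith) h0.le
    linarith [mul_pos hℓ0 h0]

end Arrivals

end PrismOutcome

/-! ### Probability of the typical event. -/

section Model

variable {Ω : Type*} [MeasurableSpace Ω] {P : Measure Ω} {m : ℕ} {Tx : Type*}
  {S : Ω → PrismOutcome m Tx} {α β δ Δ : ℝ}

namespace IsPrismModel

theorem measurableSet_lt_numAdversarial (hS : IsPrismModel P S α β Δ) (j : Fin (m + 1))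
    (s t a : ℝ) : MeasurableSet {ω | a < ((S ω).numAdversarial j s t : ℝ)} := by
  have hk : ∀ k, MeasurableSet {ω | k ∈ (S ω).minedDuring j s t ∧ ¬ (S ω).honest (j, k)} :=
    fun k => ((measurableSet_lt measurable_const (hS.measurable_minedAt (j, k))).inter
      (measurableSet_le (hS.measurable_minedAt (j, k)) measurable_const)).inter
      (hS.measurableSet_honest (j, k)).compl
  -- The count exceeds `a` exactly when some finite set of more than `a` indices consists of
  -- adversarial blocks in the window; there are only countably many such sets.
  have : {ω | a < ((S ω).numAdversarial j s t : ℝ)} =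
      ⋃ F : Finset ℕ, ⋃ (_ : a < F.card), ⋂ k, ⋂ (_ : k ∈ F),
        {ω | k ∈ (S ω).minedDuring j s t ∧ ¬ (S ω).honest (j, k)} := by
    ext ω
    have hfin : {k ∈ (S ω).minedDuring j s t | ¬ (S ω).honest (j, k)}.Finite :=
      ((hS.valid ω).finite_minedDuring j s t).subset fun _ hk => hk.1
    simp only [Set.mem_iUnion, Set.mem_iInter, Set.mem_ofPred_eq, exists_prop]
    constructor
    · intro h
      refine ⟨hfin.toFinset, ?_, fun k hk => hfin.mem_toFinset.mp hk⟩
      rwa [← Set.ncard_eq_toFinset_card _ hfin]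
    · rintro ⟨F, hF, hmem⟩
      have h1 : F.card ≤ (S ω).numAdversarial j s t := by
        rw [← Set.ncard_coe_finset]
        exact Set.ncard_le_ncard (fun k hk => hmem k hk) hfin
      exact hF.trans_le (by exact_mod_cast h1)
  rw [this]
  exact MeasurableSet.iUnion fun F => MeasurableSet.iUnion fun _ => MeasurableSet.iInter fun k =>
    MeasurableSet.iInter fun _ => hk k

theorem measure_not_honestGaps_pos (hS : IsPrismModel P S α β Δ) (hα : 0 < α) (j : Fin (m + 1)) (i : ℕ) :
    P {ω | ¬ 0 < (S ω).honestGaps j i} = 0 := by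
  have := isProbabilityMeasure_expMeasure hα
  have h := (hS.honest_law j i).measure_eq (p := fun x => ¬ 0 < x) measurableSet_Ioi.compl
  refine h.trans ?_
  have h1 : {x : ℝ | ¬ 0 < x} = (Set.Ioi 0)ᶜ := rfl
  rw [h1, prob_compl_eq_zero_iff measurableSet_Ioi, expMeasure_Ioi hα le_rfl]
  simp

theorem measure_honestGaps_mem (hS : IsPrismModel P S α β Δ)
    [IsProbabilityMeasure (expMeasure α)] (j : Fin (m + 1)) {B : Set (ℕ → ℝ)}
    (hB : MeasurableSet B) :
    P {ω | (S ω).honestGaps j ∈ B} = iidLaw (expMeasure α) B := by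
  have hind : iIndepFun (fun i ω => (S ω).honestGaps j i) P :=
    hS.honest_indep.precomp (g := fun i : ℕ => (j, i)) (Prod.mk_right_injective j)
  have hae : ∀ i, AEMeasurable (fun ω => (S ω).honestGaps j i) P := fun i =>
    (hS.honest_law j i).aemeasurable
  have hmap := hind.map_fun_eq_infinitePi_map₀' hae
  have hlaw : ∀ i, P.map (fun ω => (S ω).honestGaps j i) = expMeasure α := fun i =>
    (hS.honest_law j i).map_eq
  simp_rw [hlaw] at hmap
  rw [iidLaw, ← hmap, Measure.map_apply_of_aemeasurable (aemeasurable_pi_iff.mpr hae) hB]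
  rfl

variable [IsProbabilityMeasure P]

theorem measure_lt_numAdversarial_le (hS : IsPrismModel P S α β Δ) (hα : 0 < α) (hβ : 0 ≤ β)
    (hδ : 0 < δ) (hδ' : δ < 40 / 81) (hrate : β < discount α Δ ^ 2 * α) (j : Fin (m + 1))
    {ℓ s t : ℝ} (hℓ0 : 0 ≤ ℓ) (hℓ : 80 ≤ δ * ℓ) (hs : 0 ≤ s) (hst : s < t) (hlen : t - s ≤ ℓ + 2) :
    P {ω | ℓ * β + 9 / 10 * (ℓ * discount α Δ ^ 2 * α * δ) < ((S ω).numAdversarial j s t : ℝ)} ≤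
      ENNReal.ofReal (Real.exp (-(etaParam α δ Δ / 27 * ℓ))) := by
  set a := ℓ * β + 9 / 10 * (ℓ * discount α Δ ^ 2 * α * δ)
  have ha : 0 ≤ a := by positivity
  have hmeas := hS.measurableSet_lt_numAdversarial j s t a
  have h1 := hS.adversarial_bound j s t hs hst a ha
  have h2 : {ω | ((S ω).numAdversarial j s t : ℝ) ≤ a} =
      {ω | a < ((S ω).numAdversarial j s t : ℝ)}ᶜ := by
    ext ω
    simp
  rw [h2, probReal_compl_eq_one_sub hmeas] at h1
  have hM : 0 ≤ β * (t - s) := mul_nonneg hβ (by linarith)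
  have h3 := one_sub_poisson_cdf_le (M := β * (t - s)) (a := a) (φ := δ / 2) hM (by linarith)
  have h4 := poisson_tail_le hα hβ hδ hδ' hrate hℓ (mul_le_mul_of_nonneg_left hlen hβ)
  rw [← ofReal_measureReal]
  exact ENNReal.ofReal_le_ofReal (by linarith [Real.exp_le_exp.mpr h4])

theorem measure_atypical_le (hS : IsPrismModel P S α β Δ) (hα : 1 / 2 < α) (hβ : 0 ≤ β)
    (hδ : 0 < δ) (hδ' : δ < 40 / 81) (hΔ : 0 ≤ Δ) (hrate : β < discount α Δ ^ 2 * α)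
    (j : Fin (m + 1)) {a' a'' b'' ℓ : ℝ} (ha' : 0 ≤ a') (ha'' : 0 ≤ a'') (hab : a'' < b'')
    (hlen : b'' - a'' ≤ ℓ + 2) (hℓ0 : 0 < ℓ) (hℓ : 80 ≤ δ * ℓ) :
    P {ω | (S ω).Atypical α β δ Δ j a' ℓ a'' b''} ≤
      6 * ENNReal.ofReal (Real.exp (-(etaParam α δ Δ / 27 * ℓ))) := by
  have hα0 : 0 < α := by linarith
  have := isProbabilityMeasure_expMeasure hα0
  have hm : ∀ B, MeasurableSet B → ∀ a, MeasurableSet (⋃ n, crossing B n a) := fun B hB a =>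
    MeasurableSet.iUnion fun n => measurableSet_crossing hB n a
  have hslow := measurableSet_slowSet α δ Δ ℓ (fewArrivals α δ ℓ) ((fewArrivals α δ ℓ - 1) / 2)
  have hfast := measurableSet_sum_le (ℓ + 2) (manyArrivals α δ ℓ)
  obtain ⟨-, hn, hq, -⟩ := fewArrivals_bounds hα hδ' hℓ0 hℓ
  have h1 := (hS.measure_honestGaps_mem j (hm _ hslow a')).le.trans
    ((iidLaw_iUnion_crossing_le hα0 hslow ha').trans
      (iidLaw_slowSet_le hα0 hδ hδ' hΔ hℓ0.le hn hq))
  have h2 := (hS.measure_honestGaps_mem j (hm _ hfast a'')).le.trans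
    ((iidLaw_iUnion_crossing_le hα0 hfast ha'').trans
      (iidLaw_fast_le hα0 hδ hδ' hΔ hℓ (Nat.le_ceil _)))
  have h3 := hS.measure_lt_numAdversarial_le hα0 hβ hδ hδ' hrate j hℓ0.le hℓ ha'' hab hlen
  calc _ ≤ _ := (measure_union_le _ _).trans (add_le_add_right (measure_union_le _ _) _)
    _ ≤ _ := add_le_add h1 (add_le_add h2 h3)
    _ = _ := by ring

/-- The typical event contains a measurable event of high probability. -/
theorem exists_measurableSet_subset_typicalEvent (hS : IsPrismModel P S α β Δ) (hα : 1 / 2 < α)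
    (hβ : 0 ≤ β) (hδ : 0 < δ) (hδ' : δ < 40 / 81) (hΔ : 0 ≤ Δ)
    (hrate : β < discount α Δ ^ 2 * α) {s t : ℝ} (hst : 0 < t - s) (hlong : 80 ≤ δ * (t - s)) :
    ∃ A, MeasurableSet A ∧ A ⊆ typicalEvent S α β δ Δ s t ∧
      1 - ((m : ℝ) + 1) * muParam α δ Δ * Real.exp (-(etaParam α δ Δ / 27 * (t - s))) ≤
        P.real A := by
  have hα0 : 0 < α := by linarith
  have hg := discount_pos α Δ
  have hη : 0 < etaParam α δ Δ := by rw [etaParam]; positivity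
  set κ := etaParam α δ Δ / 27 with hκ
  have hκ0 : 0 < κ := by positivity
  -- The inner window is `(s - i, t + l]`, and the outer one is a unit larger at each end, cut off
  -- at time 0. The indices `i = ⌊s - a⌋₊` and `l = ⌊b - t⌋₊` fit any interval `(a, b]`.
  let bad : Fin (m + 1) → ℕ → ℕ → Set Ω := fun j i l =>
    {ω | i ≤ s ∧ (S ω).Atypical α β δ Δ j (s - i) (t - s + i + l) (max 0 (s - i - 1)) (t + l + 1)}
  let Bad : Set Ω := ⋃ j, (⋃ i, {ω | ¬ 0 < (S ω).honestGaps j i}) ∪ ⋃ i, ⋃ l, bad j i l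
  have hbad : ∀ j i l, P (bad j i l) ≤ 6 * ENNReal.ofReal (Real.exp (-(κ * (t - s)))) *
      (ENNReal.ofReal (Real.exp (-κ)) ^ i * ENNReal.ofReal (Real.exp (-κ)) ^ l) := by
    intro j i l
    by_cases hi : (i : ℝ) ≤ s
    · have hi0 : (0 : ℝ) ≤ i := Nat.cast_nonneg i
      have hl0 : (0 : ℝ) ≤ l := Nat.cast_nonneg l
      have hmax : max 0 (s - i - 1) ≤ s - i := max_le (by linarith) (by linarith)
      refine (measure_mono fun ω hω => hω.2).trans ((hS.measure_atypical_le hα hβ hδ hδ' hΔ hrate j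
        (by linarith) (le_max_left _ _) (by linarith) ?_ (by linarith) ?_).trans (le_of_eq ?_))
      · linarith [le_max_right 0 (s - i - 1)]
      · nlinarith
      · rw [← ENNReal.ofReal_pow (Real.exp_pos _).le, ← ENNReal.ofReal_pow (Real.exp_pos _).le,
          ← Real.exp_nat_mul, ← Real.exp_nat_mul, ← ENNReal.ofReal_mul (Real.exp_pos _).le, mul_assoc,
          ← ENNReal.ofReal_mul (Real.exp_pos _).le, ← Real.exp_add, ← Real.exp_add]
        congr 3
        ring
    · have : bad j i l = ∅ := by
        ext ω
        simp [bad, hi]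
      rw [this, measure_empty]
      exact zero_le
  have hr1 : Real.exp (-κ) < 1 := Real.exp_lt_one_iff.mpr (by linarith)
  have hgeom : ∑' i : ℕ, ENNReal.ofReal (Real.exp (-κ)) ^ i =
      ENNReal.ofReal ((1 - Real.exp (-κ))⁻¹) := by
    rw [ENNReal.tsum_geometric, ENNReal.ofReal_inv_of_pos (by linarith),
      ENNReal.ofReal_sub _ (Real.exp_pos _).le, ENNReal.ofReal_one]
  have hBad : P Bad ≤ ENNReal.ofReal (((m : ℝ) + 1) * muParam α δ Δ * Real.exp (-(κ * (t - s)))) := by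
    have hj : ∀ j, P ((⋃ i, {ω | ¬ 0 < (S ω).honestGaps j i}) ∪ ⋃ i, ⋃ l, bad j i l) ≤
        ENNReal.ofReal (muParam α δ Δ * Real.exp (-(κ * (t - s)))) := by
      intro j
      have h0 : P (⋃ i, {ω | ¬ 0 < (S ω).honestGaps j i}) = 0 :=
        measure_iUnion_null fun i => hS.measure_not_honestGaps_pos hα0 j i
      refine (measure_union_le _ _).trans ?_
      rw [h0, zero_add]
      calc P (⋃ i, ⋃ l, bad j i l)
          ≤ ∑' i, ∑' l, P (bad j i l) := (measure_iUnion_le _).trans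
            (ENNReal.tsum_le_tsum fun i => measure_iUnion_le _)
        _ ≤ ∑' i : ℕ, ∑' l : ℕ, 6 * ENNReal.ofReal (Real.exp (-(κ * (t - s)))) *
              (ENNReal.ofReal (Real.exp (-κ)) ^ i * ENNReal.ofReal (Real.exp (-κ)) ^ l) :=
            ENNReal.tsum_le_tsum fun i => ENNReal.tsum_le_tsum fun l => hbad j i l
        _ = ENNReal.ofReal (6 * Real.exp (-(κ * (t - s))) *
              ((1 - Real.exp (-κ))⁻¹ * (1 - Real.exp (-κ))⁻¹)) := by
            simp_rw [ENNReal.tsum_mul_left, ENNReal.tsum_mul_right, hgeom]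
            have h6 : (6 : ENNReal) = ENNReal.ofReal 6 := by simp
            have hinv : 0 ≤ (1 - Real.exp (-κ))⁻¹ := inv_nonneg.mpr (by linarith)
            rw [h6, ← ENNReal.ofReal_mul (by norm_num), ← ENNReal.ofReal_mul hinv,
              ← ENNReal.ofReal_mul (by positivity)]
        -- The double geometric series gives the constant 6 (four slow events, one fast, one
        -- adversarial); `muParam` allows 9 times an exponential that is at least 1.
        _ ≤ _ := by
            refine ENNReal.ofReal_le_ofReal ?_
            have h1 : -(1 / 27 * etaParam α δ Δ) = -κ := by rw [hκ]; ring
            have h2 : 1 ≤ Real.exp (2 / 27 * etaParam α δ Δ) := Real.one_le_exp (by positivity)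
            have h3 : 0 ≤ (1 - Real.exp (-κ))⁻¹ * (1 - Real.exp (-κ))⁻¹ := mul_self_nonneg _
            have h4 : 0 ≤ Real.exp (-(κ * (t - s))) *
                ((1 - Real.exp (-κ))⁻¹ * (1 - Real.exp (-κ))⁻¹) :=
              mul_nonneg (Real.exp_pos _).le h3
            rw [muParam, h1, div_eq_mul_inv, sq, mul_inv]
            nlinarith
    refine (measure_iUnion_le _).trans ((ENNReal.tsum_le_tsum hj).trans (le_of_eq ?_))
    rw [tsum_fintype, Finset.sum_const, Finset.card_univ, Fintype.card_fin, nsmul_eq_mul, mul_assoc,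
      ENNReal.ofReal_mul (p := (m : ℝ) + 1) (by positivity)]
    congr 1
    rw [← Nat.cast_succ, ENNReal.ofReal_natCast]
  -- The gaps are only known to be almost everywhere measurable, so `Bad` is replaced by a
  -- measurable superset of the same probability.
  refine ⟨(toMeasurable P Bad)ᶜ, (measurableSet_toMeasurable P Bad).compl, ?_, ?_⟩
  · intro ω hω j a b ha has hbt
    have hωBad : ω ∉ Bad := fun h => hω (subset_toMeasurable P Bad h)
    have hωj : ω ∉ (⋃ i, {ω | ¬ 0 < (S ω).honestGaps j i}) ∪ ⋃ i, ⋃ l, bad j i l :=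
      fun h => hωBad (Set.mem_iUnion.mpr ⟨j, h⟩)
    have hpos : ∀ i, 0 < (S ω).honestGaps j i := by
      intro i
      by_contra h
      exact hωj (Or.inl (Set.mem_iUnion.mpr ⟨i, h⟩))
    have hi1 := Nat.floor_le (sub_nonneg.mpr has)
    have hi2 := Nat.lt_floor_add_one (s - a)
    have hl1 := Nat.floor_le (sub_nonneg.mpr hbt)
    have hl2 := Nat.lt_floor_add_one (b - t)
    have hnot : ¬ (S ω).Atypical α β δ Δ j (s - ⌊s - a⌋₊) (t - s + ⌊s - a⌋₊ + ⌊b - t⌋₊)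
        (max 0 (s - ⌊s - a⌋₊ - 1)) (t + ⌊b - t⌋₊ + 1) := fun h =>
      hωj (Or.inr (Set.mem_iUnion.mpr ⟨⌊s - a⌋₊, Set.mem_iUnion.mpr ⟨⌊b - t⌋₊, by linarith, h⟩⟩))
    have hi0 : (0 : ℝ) ≤ ⌊s - a⌋₊ := Nat.cast_nonneg _
    have hl0 : (0 : ℝ) ≤ ⌊b - t⌋₊ := Nat.cast_nonneg _
    refine (hS.valid ω).good_of_not_atypical hpos hα hβ hδ hδ' (le_max_left _ _)
      (max_le ha (by linarith)) (by linarith) (by linarith) (by linarith) ?_ (by linarith) ?_ hnot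
    · linarith [le_max_right 0 (s - ⌊s - a⌋₊ - 1)]
    · nlinarith
  · rw [probReal_compl_eq_one_sub (measurableSet_toMeasurable P Bad), measureReal_def,
      measure_toMeasurable]
    have hμ : 0 ≤ muParam α δ Δ := by rw [muParam]; positivity
    exact sub_le_sub_left (ENNReal.toReal_le_of_le_ofReal (by positivity) hBad) 1

end IsPrismModel

end Model

theorem mainTheorem6 {Ω : Type*} [MeasurableSpace Ω] (P : Measure Ω) [IsProbabilityMeasure P]
    {Tx Out : Type*} (spends : Tx → Set Out) (m : ℕ) (hm : 1 ≤ m)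
    (α β δ Δ : ℝ) (hα : 1 / 2 < α) (hβ : 0 ≤ β) (hδ : 0 < δ) (hδ' : δ < 40 / 81) (hΔ : 0 < Δ)
    (hrate : β < (1 - 81 / 40 * δ) * discount α Δ ^ 2 * α)
    (S : Ω → PrismOutcome m Tx) (hS : IsPrismModel P S α β Δ)
    (k : ℕ) (hk : 160 * α * (1 + Δ) / δ ≤ k) (r t : ℝ)
    (ht : t = r + 2 * ((k : ℝ) + 1) /
      ((1 - 41 / 40 * δ) ^ 2 * discount α Δ ^ 2 * (1 - discount α Δ) ^ 2 * α) + Δ) :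
    (∀ ω ∈ typicalEvent S α β δ Δ (t - k / (2 * α) + Δ) (t - Δ), ∀ tx : Tx,
      (S ω).CredibleTx spends tx t →
      (∃ d, tx ∈ (S ω).txs d ∧ (S ω).publishedAt d ≤ (r : EReal)) →
      (S ω).PermanentTx spends Δ tx t) ∧
    ∃ A : Set Ω, MeasurableSet A ∧
      A ⊆ typicalEvent S α β δ Δ (t - k / (2 * α) + Δ) (t - Δ) ∧
      1 - ((m : ℝ) + 1) * muParam α δ Δ *
        Real.exp (-(etaParam α δ Δ / 27 * ((k : ℝ) / (2 * α) - 2 * Δ))) ≤ P.real A ∧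
      ∀ ω ∈ A, ∀ tx : Tx,
        (S ω).CredibleTx spends tx t →
        (∃ d, tx ∈ (S ω).txs d ∧ (S ω).publishedAt d ≤ (r : EReal)) →
        (S ω).PermanentTx spends Δ tx t := by
  have hperm : ∀ ω ∈ typicalEvent S α β δ Δ (t - k / (2 * α) + Δ) (t - Δ), ∀ tx : Tx,
      (S ω).CredibleTx spends tx t →
      (∃ d, tx ∈ (S ω).txs d ∧ (S ω).publishedAt d ≤ (r : EReal)) →
      (S ω).PermanentTx spends Δ tx t := fun ω hω tx hcred htx =>
    PrismOutcome.permanentTx_of_typical (hS.valid ω) hm hα hδ hδ' hΔ hrate hk ht hω hcred htx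
  have hg := discount_pos α Δ
  have hrate' : β < discount α Δ ^ 2 * α := by
    have : 0 < δ * (discount α Δ ^ 2 * α) := mul_pos hδ (mul_pos (by positivity) (by linarith))
    linarith
  have hlong : 80 ≤ δ * ((k : ℝ) / (2 * α) - 2 * Δ) := by
    rw [div_le_iff₀ hδ] at hk
    have : 80 * (1 + Δ) ≤ δ * (k / (2 * α)) := by
      rw [← mul_div_assoc, le_div_iff₀ (by linarith)]
      linarith
    nlinarith
  have hlen : t - Δ - (t - k / (2 * α) + Δ) = (k : ℝ) / (2 * α) - 2 * Δ := by ring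
  obtain ⟨A, hA, hsub, hprob⟩ := hS.exists_measurableSet_subset_typicalEvent hα hβ hδ hδ' hΔ.le
    hrate' (s := t - k / (2 * α) + Δ) (t := t - Δ) (by rw [hlen]; nlinarith) (by rwa [hlen])
  rw [hlen] at hprob
  exact ⟨hperm, A, hA, hsub, hprob, fun ω hω => hperm ω (hsub hω)⟩
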